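/- Let $a\in(0,1)$. Let $A_1,A_2,A_3$ be the standard basis of $\mathfrak{so}(3)$ (infinitesimal rotations about the coordinate axes), and consider on $SO(3)$ the left-invariant sub-Riemannian structure with orthonormal frame $RX_1,RX_2$, where $X_1=A_2$ and $X_2=\sqrt{1-a^2}\,A_1$. A \emph{geodesic} is a horizontal curve $R:\mathbb{R}\to SO(3)$ parametrized by arclength all of whose short arcs are length minimizers. A \emph{covector curve} of $R$ is a solution $p_t=(p_1,p_2,p_3)$, together with $R_t$, of the Hamiltonian system $$\dot R=R(p_1X_1+p_2X_2),\qquad \dot p_1=p_3p_2,\quad \dot p_2=-p_3p_1,\quad \dot p_3=a^2p_1p_2,\qquad p_1^2+p_2^2=1 .$$ Let $E=2p_3^2-a^2(p_1^2-p_2^2)$, which is constant along solutions, let $C_1=\{p_1^2+p_2^2=1,\ -a^2<E<a^2\}$ and $C_2=\{p_1^2+p_2^2=1,\ E>a^2\}$, and define the modulus $k\in(0,1)$ by $E=a^2(2k^2-1)$ on $C_1$ and by $E=a^2(2/k^2-1)$ on $C_2$. With $$K(k^2)=\int_0^{\pi/2}\frac{d\theta}{\sqrt{1-k^2\sin^2\theta}},\qquad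 \Pi(n;k^2)=\int_0^{\pi/2}\frac{d\theta}{(1-n\sin^2\theta)\sqrt{1-k^2\sin^2\theta}},$$ put $$G_1(a,k)=\sqrt{\tfrac{1-a^2(1-k^2)}{a^2(1-a^2)}}\;\Pi\!\left(\tfrac{a^2k^2}{a^2-1};k^2\right),\qquad G_2(a,k)=\sqrt{\tfrac{k^2+a^2(1-k^2)}{a^2(1-a^2)}}\;\Pi\!\left(\tfrac{a^2}{a^2-1};k^2\right).$$ Call two curves \emph{congruent} if they differ by a left translation, a shift of time, and conjugation by a diagonal matrix in $SO(3)$ (these conjugations are isometries). Then there are infinitely many pairwise non-congruent periodic geodesics $R$ with $R_0=\mathrm{Id}$. More precisely: (1) For every reduced fraction $n/m>1/a$ ($n,m\in\mathbb{N}$, $m\ge 1$) there is exactly one $k\in(0,1)$ with $G_1(a,k)=\frac{\pi}{2}\frac{n}{m}$. There is a solution of the Hamiltonian system with $R_0=\mathrm{Id}$ whose covector lies in $C_1$ and has this modulus; and for every solution $(R,p)$ with covector in $C_1$ and this modulus, $R$ is a periodic geodesic, with smallest positive period $m\cdot 4K(k^2)/a$. Conversely, if $(R,p)$ is a solution with covector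 in $C_1$ and $R$ is periodic, then its modulus satisfies $G_1(a,k)=\frac{\pi}{2}\frac{n}{m}$ for some reduced fraction $n/m>1/a$. Two such curves are congruent if and only if their fractions coincide; so for each fraction there is exactly one periodic geodesic up to congruence. (2) The same holds with $C_2$, $G_2$, the condition $n/m>1$ and the smallest period $m\cdot 4kK(k^2)/a$ in place of $C_1$, $G_1$, $n/m>1/a$ and $m\cdot 4K(k^2)/a$. -/

import Mathlib

open Real Set MeasureTheory

noncomputable section

namespace SRSO3

/-- The rotation group `SO(3)`. -/
abbrev SO3 : Type := Matrix.specialOrthogonalGroup (Fin 3) ℝ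

/-- The standard basis of `so(3)`: infinitesimal rotations about the coordinate axes. -/
def A₁ : Matrix (Fin 3) (Fin 3) ℝ := !![0, 0, 0; 0, 0, -1; 0, 1, 0]

/-- The infinitesimal rotation about the second axis. -/
def A₂ : Matrix (Fin 3) (Fin 3) ℝ := !![0, 0, 1; 0, 0, 0; -1, 0, 0]

/-- The orthonormal frame (at the identity) of the left-invariant sub-Riemannian structure with
parameter `a`: `X₁ = A₂` and `X₂ = √(1 - a²) A₁`. -/
def X₁ : Matrix (Fin 3) (Fin 3) ℝ := A₂

/-- The second vector of the orthonormal frame. -/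
def X₂ (a : ℝ) : Matrix (Fin 3) (Fin 3) ℝ := √(1 - a ^ 2) • A₁

/-- The curve `R` has at time `t` the velocity `R(t) (u₁ X₁ + u₂ X₂)` (derivatives of the matrix
entries). -/
def HasVelocityAt (a : ℝ) (R : ℝ → SO3) (u₁ u₂ t : ℝ) : Prop :=
  ∀ i j, HasDerivAt (fun τ => (R τ).1 i j) (((R t).1 * (u₁ • X₁ + u₂ • X₂ a)) i j) t

/-- `R` is a (Lipschitz) horizontal curve on `[s, t]` and `u` is its control, i.e.
`R' = R (u₁ X₁ + u₂ X₂)` almost everywhere on `[s, t]`. -/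
def IsHorizontalOn (a : ℝ) (R : ℝ → SO3) (u : ℝ → ℝ × ℝ) (s t : ℝ) : Prop :=
  (∃ K : NNReal, ∀ i j, LipschitzOnWith K (fun τ => (R τ).1 i j) (Icc s t)) ∧
  ∀ᵐ τ ∂volume.restrict (Icc s t), HasVelocityAt a R (u τ).1 (u τ).2 τ

/-- The sub-Riemannian length on `[s, t]` of a horizontal curve with control `u`. -/
def length (u : ℝ → ℝ × ℝ) (s t : ℝ) : ℝ :=
  ∫ τ in s..t, √((u τ).1 ^ 2 + (u τ).2 ^ 2)

/-- The arc on `[s, t]` of the horizontal curve `R` with control `u` has the smallest length among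
all horizontal curves with the same end points. -/
def IsMinimizingArc (a : ℝ) (R : ℝ → SO3) (u : ℝ → ℝ × ℝ) (s t : ℝ) : Prop :=
  ∀ (T : ℝ) (Q : ℝ → SO3) (v : ℝ → ℝ × ℝ), 0 ≤ T → IsHorizontalOn a Q v 0 T →
    Q 0 = R s → Q T = R t → length u s t ≤ length v 0 T

/-- A geodesic, parametrized by arclength on the whole line: a horizontal curve of unit speed all
of whose short arcs are length minimizers. -/
def IsGeodesic (a : ℝ) (R : ℝ → SO3) : Prop :=
  ∃ u : ℝ → ℝ × ℝ,
    (∀ s t, s ≤ t → IsHorizontalOn a R u s t) ∧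
    (∀ᵐ τ, (u τ).1 ^ 2 + (u τ).2 ^ 2 = 1) ∧
    ∀ τ, ∃ ε > 0, IsMinimizingArc a R u (τ - ε) (τ + ε)

/-- A covector `p ∈ so(3)*`, through its coordinates `pᵢ = ⟨p, Xᵢ⟩`. -/
@[ext] structure Covector where
  p₁ : ℝ
  p₂ : ℝ
  p₃ : ℝ

/-- `(R, p)` is a (normal) extremal: a solution of the Hamiltonian system of the Pontryagin maximum
principle with Hamiltonian `(p₁² + p₂²) / 2`. -/
structure IsExtremal (a : ℝ) (R : ℝ → SO3) (p : ℝ → Covector) : Prop where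
  horizontal : ∀ t, HasVelocityAt a R (p t).p₁ (p t).p₂ t
  deriv_p₁ : ∀ t, HasDerivAt (fun τ => (p τ).p₁) ((p t).p₃ * (p t).p₂) t
  deriv_p₂ : ∀ t, HasDerivAt (fun τ => (p τ).p₂) (-((p t).p₃ * (p t).p₁)) t
  deriv_p₃ : ∀ t, HasDerivAt (fun τ => (p τ).p₃) (a ^ 2 * (p t).p₁ * (p t).p₂) t

/-- The energy `E = 2 p₃² - a² cos 2ψ` of the pendulum, where `p₁ = cos ψ`, `p₂ = - sin ψ`; it is
constant along extremals. -/
def energy (a : ℝ) (p : Covector) : ℝ := 2 * p.p₃ ^ 2 - a ^ 2 * (p.p₁ ^ 2 - p.p₂ ^ 2)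

/-- The region `C₁` of the cylinder `p₁² + p₂² = 1` (oscillating pendulum). -/
def C₁ (a : ℝ) : Set Covector :=
  {p | p.p₁ ^ 2 + p.p₂ ^ 2 = 1 ∧ energy a p ∈ Ioo (-a ^ 2) (a ^ 2)}

/-- The region `C₂` of the cylinder `p₁² + p₂² = 1` (rotating pendulum). -/
def C₂ (a : ℝ) : Set Covector :=
  {p | p.p₁ ^ 2 + p.p₂ ^ 2 = 1 ∧ energy a p ∈ Ioi (a ^ 2)}

/-- The elliptic coordinate `k ∈ (0, 1)` on `C₁`, where `E = a² (2 k² - 1)`: there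
`p = (±dn, ∓k sn, a k cn)`. -/
def modulus₁ (a : ℝ) (p : Covector) : ℝ := √((energy a p + a ^ 2) / (2 * a ^ 2))

/-- The elliptic coordinate `k ∈ (0, 1)` on `C₂`, where `E = a² (2 / k² - 1)`: there
`p = (cn, ∓sn, ±(a / k) dn)`. -/
def modulus₂ (a : ℝ) (p : Covector) : ℝ := √(2 * a ^ 2 / (energy a p + a ^ 2))

/-- The complete elliptic integral of the first kind `K(μ)`, in the parameter `μ = k²`. -/
def ellipticK (μ : ℝ) : ℝ := ∫ θ in (0 : ℝ)..(π / 2), 1 / √(1 - μ * sin θ ^ 2)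

/-- The complete elliptic integral of the third kind `Π(n; μ)`, in the parameter `μ = k²`. -/
def ellipticPi (n μ : ℝ) : ℝ :=
  ∫ θ in (0 : ℝ)..(π / 2), 1 / ((1 - n * sin θ ^ 2) * √(1 - μ * sin θ ^ 2))

def G₁ (a k : ℝ) : ℝ :=
  √((1 - a ^ 2 * (1 - k ^ 2)) / (a ^ 2 * (1 - a ^ 2))) *
    ellipticPi (a ^ 2 * k ^ 2 / (a ^ 2 - 1)) (k ^ 2)

def G₂ (a k : ℝ) : ℝ :=
  √((k ^ 2 + a ^ 2 * (1 - k ^ 2)) / (a ^ 2 * (1 - a ^ 2))) *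
    ellipticPi (a ^ 2 / (a ^ 2 - 1)) (k ^ 2)

/-- The curve `R` is periodic. -/
def IsPeriodic (R : ℝ → SO3) : Prop := ∃ L > 0, Function.Periodic R L

/-- `L` is the smallest positive period of the curve `R`. -/
def IsMinimalPeriod (R : ℝ → SO3) (L : ℝ) : Prop :=
  IsLeast {L : ℝ | 0 < L ∧ Function.Periodic R L} L

/-- Two curves are congruent if they differ by a left translation, a shift of time and
conjugation by a diagonal rotation `S` (the identity or the rotation by `π` about a coordinate
axis; these conjugations are isometries of the sub-Riemannian structure). -/
def Congruent (R Q : ℝ → SO3) : Prop :=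
  ∃ (g S : SO3) (t₀ : ℝ), S.1.IsDiag ∧ ∀ t, Q t = g * (S * R (t + t₀) * S⁻¹)

end SRSO3

end

noncomputable section

namespace SRSO3

section

/-! ### Elliptic integrals -/

/-! Put b = `√(1 - a ^ 2)`. The Hamiltonian system is an Euler top: the body angular momentum (p₂/b,
p₁, p₃/b) satisfies a Lax equation, so its conjugate by R is fixed in space. Rotate space so that
the momentum, of constant length m, points along the third axis. Then R becomes `rotZ θ` times a
frame F(p) that depends on the covector alone, and the precession angle obeys θ' = m/s², where s is
the planar part of the momentum (`hasDerivAt_momentFrame`).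

On C₁ and C₂ the covector is an explicit function of an amplitude φ with φ' = ω√(1 - k² sin² φ), and
s² = 1 + ν sin² φ. Hence p closes up exactly after multiples of 4K/ω, and θ is an incomplete
integral of the third kind in φ, growing by 4(m/ω)Π(-ν; k²) = 4G per period. So R has period L iff L
= j·4K/ω and 4jG lies in 2πℤ (`EllipticCoordinates.periodic_iff`). With G = (π/2)n/m reduced, the
least such j is m.

It remains to see which fractions occur. G₁ and G₂ are continuous and strictly increasing on [0, 1),
start at π/(2a) and π/2, and are unbounded because K is. Monotonicity of G₁ is the delicate point:
the substitution tan α = l tan θ turns it into an integral with monotone integrand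
(`sqrt_mul_ellipticPi`).

For congruence, the curve determines its covector, and congruence changes p only by signs and a time
shift, so E and hence k are invariant. Conversely, amplitudes of equal modulus differ by a time
shift, and the remaining sign is realized by a diagonal rotation.

Minimality of short arcs (`IsExtremal.exists_short_arc_le`) is a direct comparison. A shorter
competitor is set against the arc reparametrized proportionally to the competitor's speed. Pairing
the defect between the two curves with the conserved momentum gives an integral that vanishes.
Strict convexity of the norm makes its first-order part negative by at least W²/(4T), W being the L¹
norm of the control difference, while the higher-order error is O(W²) with a constant independent of
the arc length T. This is impossible for small T. -/

lemma mul_sin_sq_lt_one {μ : ℝ} (h1 : μ < 1) (θ : ℝ) : 0 < 1 - μ * sin θ ^ 2 := by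
  rcases le_total μ 0 with h | h
  · nlinarith [sq_nonneg (sin θ)]
  · nlinarith [sin_sq_le_one θ]

lemma sq_mem_Ico {k : ℝ} (hk : k ∈ Ico (0 : ℝ) 1) : k ^ 2 ∈ Ico (0 : ℝ) 1 :=
  ⟨sq_nonneg k, by nlinarith [hk.1, hk.2]⟩

lemma one_add_mul_sin_sq_pos {ν : ℝ} (hν : 0 ≤ ν) (θ : ℝ) : 0 < 1 + ν * sin θ ^ 2 := by
  positivity

lemma continuous_ellipticK_integrand {μ : ℝ} (h1 : μ < 1) :
    Continuous fun θ => 1 / √(1 - μ * sin θ ^ 2) := by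
  refine continuous_const.div (by fun_prop) fun θ => ?_
  exact (sqrt_pos.2 (mul_sin_sq_lt_one h1 θ)).ne'

lemma continuous_ellipticPi_integrand {ν μ : ℝ} (hν : 0 ≤ ν) (h1 : μ < 1) :
    Continuous fun θ => 1 / ((1 + ν * sin θ ^ 2) * √(1 - μ * sin θ ^ 2)) := by
  refine continuous_const.div (by fun_prop) fun θ => ?_
  exact (mul_pos (one_add_mul_sin_sq_pos hν θ) (sqrt_pos.2 (mul_sin_sq_lt_one h1 θ))).ne'

lemma ellipticPi_neg (ν μ : ℝ) : ellipticPi (-ν) μ =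
    ∫ θ in (0 : ℝ)..(π / 2), 1 / ((1 + ν * sin θ ^ 2) * √(1 - μ * sin θ ^ 2)) := by
  simp [ellipticPi]

lemma continuousOn_ellipticPi {ν : ℝ → ℝ} (hν : Continuous ν) (hν0 : ∀ k, 0 ≤ ν k) :
    ContinuousOn (fun k => ellipticPi (-(ν k)) (k ^ 2)) (Ico 0 1) := by
  rw [continuousOn_iff_continuous_domRestrict]
  have : (Ico (0:ℝ) 1).domRestrict (fun k => ellipticPi (-(ν k)) (k ^ 2)) =
      fun k : Ico (0:ℝ) 1 => ∫ θ in (0 : ℝ)..(π / 2),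
        1 / ((1 + ν k * sin θ ^ 2) * √(1 - (k:ℝ) ^ 2 * sin θ ^ 2)) := by
    ext k; exact ellipticPi_neg _ _
  rw [this]
  apply intervalIntegral.continuous_parametric_intervalIntegral_of_continuous'
  refine continuous_const.div (by fun_prop) fun ⟨k, θ⟩ => ?_
  exact (mul_pos (one_add_mul_sin_sq_pos (hν0 k) θ)
    (sqrt_pos.2 (mul_sin_sq_lt_one (sq_mem_Ico k.2).2 θ))).ne'

/-- With ε² = 1 - μ one has 1 - μ sin² θ = cos² θ + ε² sin² θ ≤ (π/2 - θ + ε)², because cos θ ≤ π/2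
- θ. The reciprocal of π/2 - θ + ε integrates to a logarithm, which makes K unbounded as μ tends to
1. -/
lemma ellipticK_lower_bound {μ : ℝ} (h1 : μ < 1) :
    log (π / 2 / √(1 - μ)) ≤ ellipticK μ := by
  set ε := √(1 - μ) with hε
  have hε0 : 0 < ε := sqrt_pos.2 (by linarith)
  have hε2 : ε ^ 2 = 1 - μ := sq_sqrt (by linarith)
  have hint : ∫ θ in (0 : ℝ)..(π / 2), (π / 2 + ε - θ)⁻¹ = log ((π / 2 + ε) / ε) := by
    rw [intervalIntegral.integral_comp_sub_left (fun x => x⁻¹)]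
    rw [integral_inv_of_pos (by linarith) (by linarith [pi_pos])]
    congr 2 <;> ring
  calc log (π / 2 / ε) ≤ log ((π / 2 + ε) / ε) := by
        apply log_le_log (by positivity)
        gcongr; linarith
    _ = ∫ θ in (0 : ℝ)..(π / 2), (π / 2 + ε - θ)⁻¹ := hint.symm
    _ ≤ ellipticK μ := by
        refine intervalIntegral.integral_mono_on (by positivity) ?_
          (continuous_ellipticK_integrand h1).continuousOn.intervalIntegrable fun θ hθ => ?_
        · refine ContinuousOn.intervalIntegrable fun θ hθ => ContinuousAt.continuousWithinAt ?_
          rw [uIcc_of_le (by positivity)] at hθ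
          exact ContinuousAt.inv₀ (by fun_prop) (by linarith [hθ.2])
        · rw [one_div]
          have hpos := mul_sin_sq_lt_one h1 θ
          apply inv_anti₀ (sqrt_pos.2 hpos)
          rw [sqrt_le_iff]
          refine ⟨by linarith [hθ.2], ?_⟩
          have hcos : cos θ ≤ π / 2 - θ := by
            rw [← sin_pi_div_two_sub]; exact sin_le (by linarith [hθ.2])
          have hcos0 : 0 ≤ cos θ := cos_nonneg_of_mem_Icc ⟨by linarith [hθ.1, pi_pos], hθ.2⟩
          have h3 : cos θ ^ 2 ≤ (π / 2 - θ) ^ 2 := by gcongr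
          nlinarith [sin_sq_add_cos_sq θ, sin_sq_le_one θ, sq_nonneg (sin θ),
            mul_nonneg hε0.le (show 0 ≤ π / 2 - θ by linarith [hθ.2])]

lemma exists_ellipticK_gt (y : ℝ) : ∃ k ∈ Ioo (0 : ℝ) 1, y < ellipticK (k ^ 2) := by
  obtain ⟨ε, hε0, hε1, hε⟩ : ∃ ε : ℝ, 0 < ε ∧ ε < 1 ∧ exp y * ε < π / 2 := by
    refine ⟨min (1 / 2) (1 / exp y), by positivity, by
      exact (min_le_left _ _).trans_lt (by norm_num), ?_⟩
    calc exp y * min (1 / 2) (1 / exp y) ≤ exp y * (1 / exp y) := by gcongr; exact min_le_right _ _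
      _ = 1 := by field_simp
      _ < π / 2 := by linarith [pi_gt_three]
  have h2 : ε ^ 2 < 1 := by nlinarith
  have hk2 : √(1 - ε ^ 2) ^ 2 = 1 - ε ^ 2 := sq_sqrt (by linarith)
  refine ⟨√(1 - ε ^ 2), ⟨sqrt_pos.2 (by linarith), ?_⟩, ?_⟩
  · rw [sqrt_lt' one_pos]; nlinarith
  · refine lt_of_lt_of_le ?_ (ellipticK_lower_bound (by rw [hk2]; nlinarith))
    rw [hk2, sub_sub_cancel, sqrt_sq hε0.le, lt_log_iff_exp_lt (by positivity), lt_div_iff₀ hε0]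
    exact hε

lemma ellipticPi_lower_bound {ν μ : ℝ} (hν : 0 ≤ ν) (h1 : μ < 1) :
    1 / (1 + ν) * ellipticK μ ≤ ellipticPi (-ν) μ := by
  rw [ellipticPi_neg, ellipticK, ← intervalIntegral.integral_const_mul]
  refine intervalIntegral.integral_mono_on (by positivity)
    ((continuous_ellipticK_integrand h1).const_mul _).continuousOn.intervalIntegrable
    (continuous_ellipticPi_integrand hν h1).continuousOn.intervalIntegrable fun θ _ => ?_
  have := sqrt_pos.2 (mul_sin_sq_lt_one h1 θ)
  rw [← one_div_mul_one_div]
  have h2 : sin θ ^ 2 ≤ 1 := sin_sq_le_one θ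
  gcongr
  nlinarith

lemma ellipticK_pos {μ : ℝ} (h1 : μ < 1) : 0 < ellipticK μ :=
  intervalIntegral.intervalIntegral_pos_of_pos
    (continuous_ellipticK_integrand h1).continuousOn.intervalIntegrable
    (fun θ => one_div_pos.2 (sqrt_pos.2 (mul_sin_sq_lt_one h1 θ))) (by positivity)

lemma ellipticPi_pos {ν μ : ℝ} (hν : 0 ≤ ν) (h1 : μ < 1) : 0 < ellipticPi (-ν) μ :=
  lt_of_lt_of_le (mul_pos (by positivity) (ellipticK_pos h1)) (ellipticPi_lower_bound hν h1)

/-- The angle `α` with `tan α = l tan θ`, in a form which is smooth in `θ`. -/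
def stretchedAngle (l θ : ℝ) : ℝ :=
  θ + arctan ((l - 1) * sin θ * cos θ / (cos θ ^ 2 + l * sin θ ^ 2))

lemma cos_sq_add_mul_sin_sq_pos {l : ℝ} (hl : 0 < l) (θ : ℝ) :
    0 < cos θ ^ 2 + l * sin θ ^ 2 := by
  rcases eq_or_ne (sin θ) 0 with h | h
  · nlinarith [sin_sq_add_cos_sq θ]
  · positivity

lemma one_add_sq_stretch {l : ℝ} (hl : 0 < l) (θ : ℝ) :
    1 + ((l - 1) * sin θ * cos θ / (cos θ ^ 2 + l * sin θ ^ 2)) ^ 2 =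
      (cos θ ^ 2 + l ^ 2 * sin θ ^ 2) / (cos θ ^ 2 + l * sin θ ^ 2) ^ 2 := by
  have h := (cos_sq_add_mul_sin_sq_pos hl θ).ne'
  have h2 := sin_sq_add_cos_sq θ
  field_simp
  linear_combination (cos θ ^ 2 + l ^ 2 * sin θ ^ 2) * h2

lemma hasDerivAt_stretchedAngle {l : ℝ} (hl : 0 < l) (θ : ℝ) :
    HasDerivAt (stretchedAngle l) (l / (cos θ ^ 2 + l ^ 2 * sin θ ^ 2)) θ := by
  have h := (cos_sq_add_mul_sin_sq_pos hl θ).ne'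
  have h' := (cos_sq_add_mul_sin_sq_pos (pow_pos hl 2) θ).ne'
  have hs := hasDerivAt_sin θ
  have hc := hasDerivAt_cos θ
  have key := (hasDerivAt_id θ).add
    ((((hs.const_mul (l - 1)).mul hc).div ((hc.pow 2).add ((hs.pow 2).const_mul l)) h).arctan)
  refine HasDerivAt.congr_deriv (f := stretchedAngle l) key ?_
  simp only [Pi.add_apply, Pi.mul_apply, Pi.pow_apply, Pi.div_apply]
  rw [one_add_sq_stretch hl]
  have h2 := sin_sq_add_cos_sq θ
  field_simp
  norm_num
  linear_combination (l + (l - 1) * (cos θ ^ 2 - l * sin θ ^ 2)) * h2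

lemma sin_sq_stretchedAngle {l : ℝ} (hl : 0 < l) (θ : ℝ) :
    sin (stretchedAngle l θ) ^ 2 = l ^ 2 * sin θ ^ 2 / (cos θ ^ 2 + l ^ 2 * sin θ ^ 2) := by
  have h := (cos_sq_add_mul_sin_sq_pos hl θ).ne'
  have h' := (cos_sq_add_mul_sin_sq_pos (pow_pos hl 2) θ)
  set y := (l - 1) * sin θ * cos θ / (cos θ ^ 2 + l * sin θ ^ 2) with hy
  have h1 : 1 + y ^ 2 = _ := one_add_sq_stretch hl θ
  have e : sin (stretchedAngle l θ) = (sin θ + y * cos θ) / √(1 + y ^ 2) := by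
    rw [stretchedAngle, ← hy, sin_add, cos_arctan, sin_arctan]; ring
  have e2 : sin θ + y * cos θ = l * sin θ / (cos θ ^ 2 + l * sin θ ^ 2) := by
    have hy' : y * (cos θ ^ 2 + l * sin θ ^ 2) = (l - 1) * sin θ * cos θ := div_mul_cancel₀ _ h
    rw [eq_div_iff h]
    linear_combination cos θ * hy' + l * sin θ * sin_sq_add_cos_sq θ
  rw [e, div_pow, sq_sqrt (by positivity), h1, e2]
  field_simp

/-- For l² = 1 + cx the substitution turns the modulus term x sin² θ of the elliptic integrand into
a function of α that increases with x. -/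
lemma stretched_identity {c x : ℝ} (hc : 0 ≤ c) (hx : 0 ≤ x) (θ : ℝ) :
    x * sin (stretchedAngle (√(1 + c * x)) θ) ^ 2 /
      (1 + c * x * cos (stretchedAngle (√(1 + c * x)) θ) ^ 2) = x * sin θ ^ 2 := by
  have hl : 0 < √(1 + c * x) := sqrt_pos.2 (by positivity)
  have hl2 : √(1 + c * x) ^ 2 = 1 + c * x := sq_sqrt (by positivity)
  have hp := cos_sq_add_mul_sin_sq_pos (show 0 < 1 + c * x by positivity) θ
  have h1 := sin_sq_stretchedAngle hl θ
  rw [cos_sq', h1, hl2]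
  have h2 := sin_sq_add_cos_sq θ
  have h3 : cos θ ^ 2 = 1 - sin θ ^ 2 := by linarith
  rw [h3] at hp ⊢
  have h4 : 1 + c * x * (1 - (1 + c * x) * sin θ ^ 2 / (1 - sin θ ^ 2 + (1 + c * x) * sin θ ^ 2))
      = (1 + c * x) / (1 - sin θ ^ 2 + (1 + c * x) * sin θ ^ 2) := by
    field_simp; ring
  rw [h4]
  have : 0 < 1 + c * x := by positivity
  generalize 1 - sin θ ^ 2 + (1 + c * x) * sin θ ^ 2 = D at hp
  field_simp

lemma stretched_modulus_pos {c x : ℝ} (hc : 0 ≤ c) (hx : x ∈ Ico (0 : ℝ) 1) (α : ℝ) :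
    0 < 1 - x * sin α ^ 2 / (1 + c * x * cos α ^ 2) := by
  have hx0 := hx.1
  have : 0 < 1 + c * x * cos α ^ 2 := by positivity
  rw [sub_pos, div_lt_one this]
  have h2 : 0 ≤ c * x * cos α ^ 2 := by positivity
  nlinarith [mul_sin_sq_lt_one hx.2 α]

lemma continuous_stretched_integrand {c x : ℝ} (hc : 0 ≤ c) (hx : x ∈ Ico (0 : ℝ) 1) :
    Continuous fun α => 1 / √(1 - x * sin α ^ 2 / (1 + c * x * cos α ^ 2)) := by
  have hx0 := hx.1
  have h (α : ℝ) : 1 + c * x * cos α ^ 2 ≠ 0 := by positivity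
  refine continuous_const.div (Continuous.sqrt (continuous_const.sub
    (Continuous.div (by fun_prop) (by fun_prop) h))) fun α => ?_
  exact (sqrt_pos.2 (stretched_modulus_pos hc hx α)).ne'

/-- The prefactor grows with x while 1/(1 + cx sin² θ) shrinks, so monotonicity is hidden on the
left. The derivative of the stretched angle is l/(1 + cx sin² θ), which absorbs both factors. -/
lemma sqrt_mul_ellipticPi {c x : ℝ} (hc : 0 ≤ c) (hx : x ∈ Ico (0 : ℝ) 1) :
    √(1 + c * x) * ellipticPi (-(c * x)) x =
      ∫ α in (0 : ℝ)..(π / 2), 1 / √(1 - x * sin α ^ 2 / (1 + c * x * cos α ^ 2)) := by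
  have hx0 := hx.1
  set l := √(1 + c * x) with hl'
  have hl : 0 < l := sqrt_pos.2 (by positivity)
  have hl2 : l ^ 2 = 1 + c * x := sq_sqrt (by positivity)
  have h0 : stretchedAngle l 0 = 0 := by simp [stretchedAngle]
  have h1 : stretchedAngle l (π / 2) = π / 2 := by simp [stretchedAngle]
  have hcont : Continuous fun θ => l / (cos θ ^ 2 + l ^ 2 * sin θ ^ 2) :=
    continuous_const.div (by fun_prop) fun θ =>
      (cos_sq_add_mul_sin_sq_pos (pow_pos hl 2) θ).ne'
  have := intervalIntegral.integral_comp_mul_deriv (a := 0) (b := π / 2)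
    (fun θ _ => hasDerivAt_stretchedAngle hl θ) hcont.continuousOn
    (continuous_stretched_integrand hc hx)
  rw [h0, h1] at this
  rw [← this, ellipticPi_neg, ← intervalIntegral.integral_const_mul]
  refine intervalIntegral.integral_congr fun θ _ => ?_
  simp only [Function.comp]
  rw [hl', stretched_identity hc hx0, ← hl', hl2]
  have h3 : cos θ ^ 2 + (1 + c * x) * sin θ ^ 2 = 1 + c * x * sin θ ^ 2 := by
    linear_combination sin_sq_add_cos_sq θ
  rw [h3]
  have h4 : 0 < 1 + c * x * sin θ ^ 2 := by positivity
  have h5 := sqrt_pos.2 (mul_sin_sq_lt_one hx.2 θ)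
  field_simp

/-- With modulus zero the integrand is exactly the derivative of the stretched angle, which runs
from 0 to π/2. -/
lemma sqrt_mul_ellipticPi_zero {ν : ℝ} (hν : 0 ≤ ν) : √(1 + ν) * ellipticPi (-ν) 0 = π / 2 := by
  have hl : 0 < √(1 + ν) := sqrt_pos.2 (by positivity)
  have hl2 : √(1 + ν) ^ 2 = 1 + ν := sq_sqrt (by positivity)
  have hcont : Continuous fun θ => √(1 + ν) / (cos θ ^ 2 + √(1 + ν) ^ 2 * sin θ ^ 2) :=
    continuous_const.div (by fun_prop) fun θ =>
      (cos_sq_add_mul_sin_sq_pos (pow_pos hl 2) θ).ne'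
  have := intervalIntegral.integral_eq_sub_of_hasDerivAt (a := 0) (b := π / 2)
    (fun θ _ => hasDerivAt_stretchedAngle hl θ) (hcont.intervalIntegrable _ _)
  simp only [stretchedAngle, cos_pi_div_two, mul_zero, zero_div, arctan_zero, sin_zero, cos_zero,
    add_zero, sub_zero, zero_mul] at this
  rw [← this, ellipticPi_neg, ← intervalIntegral.integral_const_mul]
  refine intervalIntegral.integral_congr fun θ _ => ?_
  have h3 : cos θ ^ 2 + (1 + ν) * sin θ ^ 2 = 1 + ν * sin θ ^ 2 := by
    linear_combination sin_sq_add_cos_sq θ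
  simp only [hl2, h3]
  simp [div_eq_mul_inv]

lemma sqrt_mul_ellipticPi_strictMonoOn {c : ℝ} (hc : 0 ≤ c) :
    StrictMonoOn (fun x => √(1 + c * x) * ellipticPi (-(c * x)) x) (Ico 0 1) := by
  intro x hx y hy hxy
  simp only [sqrt_mul_ellipticPi hc hx, sqrt_mul_ellipticPi hc hy]
  have hx0 := hx.1
  have hy0 := hy.1
  refine intervalIntegral.integral_lt_integral_of_continuousOn_of_le_of_exists_lt (by positivity)
    (continuous_stretched_integrand hc hx).continuousOn
    (continuous_stretched_integrand hc hy).continuousOn (fun α _ => ?_)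
    -- At α = π/2 the cosine drops out and the two integrands differ strictly.
    ⟨π / 2, ⟨by positivity, le_rfl⟩, ?_⟩
  · have h1 := stretched_modulus_pos hc hy α
    have h2 : x * sin α ^ 2 / (1 + c * x * cos α ^ 2) ≤ y * sin α ^ 2 / (1 + c * y * cos α ^ 2) := by
      rw [div_le_div_iff₀ (by positivity) (by positivity)]
      nlinarith [mul_le_mul_of_nonneg_right hxy.le (sq_nonneg (sin α))]
    gcongr
  · simp only [sin_pi_div_two, cos_pi_div_two]
    have : 0 < 1 - y := by linarith [hy.2]
    norm_num
    apply inv_strictAnti₀ (sqrt_pos.2 this)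
    exact sqrt_lt_sqrt this.le (by linarith)

lemma existsUnique_of_strictMonoOn {g : ℝ → ℝ} (hm : StrictMonoOn g (Ico 0 1))
    (hc : ContinuousOn g (Ico 0 1)) (hu : ∀ y, ∃ k ∈ Ioo (0 : ℝ) 1, y < g k) {y : ℝ}
    (hy : g 0 < y) : ∃ k ∈ Ioo (0 : ℝ) 1, g k = y ∧ ∀ k' ∈ Ioo (0 : ℝ) 1, g k' = y → k' = k := by
  obtain ⟨k₁, hk₁, hk₁y⟩ := hu y
  obtain ⟨k, hk, hky⟩ := intermediate_value_Ioo hk₁.1.le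
    (hc.mono fun z hz => ⟨hz.1, hz.2.trans_lt hk₁.2⟩) ⟨hy, hk₁y⟩
  refine ⟨k, ⟨hk.1, hk.2.trans hk₁.2⟩, hky, fun k' hk' h => ?_⟩
  exact hm.injOn ⟨hk'.1.le, hk'.2⟩ ⟨hk.1.le, hk.2.trans hk₁.2⟩ (h.trans hky.symm)

/-! ### Monotonicity and range of `G₁` and `G₂` -/

section G
variable {a : ℝ}

lemma one_sub_sq_pos (ha : a ∈ Ioo (0 : ℝ) 1) : 0 < 1 - a ^ 2 := by nlinarith [ha.1, ha.2]

lemma G₁_eq (ha : a ∈ Ioo (0 : ℝ) 1) (k : ℝ) : G₁ a k =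
    1 / a * (√(1 + a ^ 2 / (1 - a ^ 2) * k ^ 2) *
      ellipticPi (-(a ^ 2 / (1 - a ^ 2) * k ^ 2)) (k ^ 2)) := by
  have hb := one_sub_sq_pos ha
  have ha0 := ha.1
  rw [G₁, ← mul_assoc]
  congr 1
  · rw [← sqrt_sq (by positivity : 0 ≤ 1 / a), ← sqrt_mul (by positivity)]
    congr 1; field_simp; ring
  · congr 1
    rw [← neg_sub (1 : ℝ) (a ^ 2)]; field_simp

lemma G₂_eq (k : ℝ) : G₂ a k =
    √((a ^ 2 + (1 - a ^ 2) * k ^ 2) / (a ^ 2 * (1 - a ^ 2))) *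
      ellipticPi (-(a ^ 2 / (1 - a ^ 2))) (k ^ 2) := by
  rw [G₂]
  congr 1
  · congr 2; ring
  · congr 1
    rw [← neg_sub (1 : ℝ) (a ^ 2), div_neg]

lemma strictMonoOn_G₁ (ha : a ∈ Ioo (0 : ℝ) 1) : StrictMonoOn (G₁ a) (Ico 0 1) := by
  intro x hx y hy hxy
  have hb := one_sub_sq_pos ha
  rw [G₁_eq ha, G₁_eq ha]
  refine mul_lt_mul_of_pos_left ?_ (one_div_pos.2 ha.1)
  exact sqrt_mul_ellipticPi_strictMonoOn (c := a ^ 2 / (1 - a ^ 2)) (by positivity)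
    (sq_mem_Ico hx) (sq_mem_Ico hy) (by have := hx.1; gcongr)

lemma continuousOn_G₁ (ha : a ∈ Ioo (0 : ℝ) 1) : ContinuousOn (G₁ a) (Ico 0 1) := by
  have hb := one_sub_sq_pos ha
  rw [funext (G₁_eq ha)]
  refine continuousOn_const.mul (ContinuousOn.mul (by fun_prop) ?_)
  exact continuousOn_ellipticPi (by fun_prop) fun k => by positivity

lemma G₁_zero (ha : a ∈ Ioo (0 : ℝ) 1) : G₁ a 0 = π / 2 * (1 / a) := by
  rw [G₁_eq ha]
  simp [ellipticPi]; ring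

lemma exists_G₁_gt (ha : a ∈ Ioo (0 : ℝ) 1) (y : ℝ) : ∃ k ∈ Ioo (0 : ℝ) 1, y < G₁ a k := by
  have hb := one_sub_sq_pos ha
  have ha0 := ha.1
  set c := a ^ 2 / (1 - a ^ 2) with hc
  have hc0 : 0 < c := by positivity
  obtain ⟨k, hk, hky⟩ := exists_ellipticK_gt (y * (1 + c) * a)
  have hk2 := sq_mem_Ico ⟨hk.1.le, hk.2⟩
  refine ⟨k, hk, ?_⟩
  rw [G₁_eq ha, ← hc]
  have h1 := ellipticPi_lower_bound (ν := c * k ^ 2) (by positivity) hk2.2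
  have hK := ellipticK_pos hk2.2
  have h2 : 1 / (1 + c) * ellipticK (k ^ 2) ≤ ellipticPi (-(c * k ^ 2)) (k ^ 2) := by
    refine le_trans ?_ h1
    have := hk2.2.le
    gcongr
    nlinarith
  have h3 : 1 ≤ √(1 + c * k ^ 2) := by
    rw [one_le_sqrt]; nlinarith [mul_nonneg hc0.le hk2.1]
  calc y < 1 / a * (1 * (1 / (1 + c) * ellipticK (k ^ 2))) := by
        field_simp; linarith
    _ ≤ _ := by gcongr

/-- Here the characteristic does not depend on k, so the prefactor and the integrand both increase
and no substitution is needed. -/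
lemma strictMonoOn_G₂ (ha : a ∈ Ioo (0 : ℝ) 1) : StrictMonoOn (G₂ a) (Ico 0 1) := by
  intro x hx y hy hxy
  have hb := one_sub_sq_pos ha
  have ha0 := ha.1
  have hx0 := hx.1
  have hx2 := sq_mem_Ico hx
  have hy2 := sq_mem_Ico hy
  rw [G₂_eq, G₂_eq]
  have hν : 0 ≤ a ^ 2 / (1 - a ^ 2) := by positivity
  refine mul_lt_mul' (sqrt_le_sqrt (by gcongr)) ?_ (ellipticPi_pos hν hx2.2).le
    (sqrt_pos.2 (by positivity))
  rw [ellipticPi_neg, ellipticPi_neg]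
  refine intervalIntegral.integral_lt_integral_of_continuousOn_of_le_of_exists_lt (by positivity)
    (continuous_ellipticPi_integrand hν hx2.2).continuousOn
    (continuous_ellipticPi_integrand hν hy2.2).continuousOn (fun α _ => ?_)
    ⟨π / 2, ⟨by positivity, le_rfl⟩, ?_⟩
  · have := sqrt_pos.2 (mul_sin_sq_lt_one hy2.2 α)
    gcongr
  · have := sqrt_pos.2 (mul_sin_sq_lt_one hy2.2 (π / 2))
    have h1 := mul_sin_sq_lt_one hy2.2 (π / 2)
    have : √(1 - y ^ 2 * sin (π / 2) ^ 2) < √(1 - x ^ 2 * sin (π / 2) ^ 2) :=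
      sqrt_lt_sqrt h1.le (by rw [sin_pi_div_two]; nlinarith)
    gcongr

lemma continuousOn_G₂ (ha : a ∈ Ioo (0 : ℝ) 1) : ContinuousOn (G₂ a) (Ico 0 1) := by
  have hb := one_sub_sq_pos ha
  rw [funext (G₂_eq (a := a))]
  refine ContinuousOn.mul (by fun_prop) ?_
  exact continuousOn_ellipticPi continuous_const fun k => by positivity

lemma G₂_zero (ha : a ∈ Ioo (0 : ℝ) 1) : G₂ a 0 = π / 2 := by
  have hb := one_sub_sq_pos ha
  have ha0 := ha.1
  have h := sqrt_mul_ellipticPi_zero (ν := a ^ 2 / (1 - a ^ 2)) (by positivity)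
  have h1 : a ^ 2 / (a ^ 2 * (1 - a ^ 2)) = 1 + a ^ 2 / (1 - a ^ 2) := by field_simp; ring
  simpa [G₂_eq, h1] using h

lemma exists_G₂_gt (ha : a ∈ Ioo (0 : ℝ) 1) (y : ℝ) : ∃ k ∈ Ioo (0 : ℝ) 1, y < G₂ a k := by
  have hb := one_sub_sq_pos ha
  have ha0 := ha.1
  set c := a ^ 2 / (1 - a ^ 2) with hc
  have hc0 : 0 < c := by positivity
  obtain ⟨k, hk, hky⟩ := exists_ellipticK_gt (y * (1 + c))
  have hk2 := sq_mem_Ico ⟨hk.1.le, hk.2⟩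
  have hK := ellipticK_pos hk2.2
  refine ⟨k, hk, ?_⟩
  rw [G₂_eq, ← hc]
  have h1 := ellipticPi_lower_bound hc0.le hk2.2
  have h3 : 1 ≤ √((a ^ 2 + (1 - a ^ 2) * k ^ 2) / (a ^ 2 * (1 - a ^ 2))) := by
    rw [one_le_sqrt, one_le_div (by positivity)]
    nlinarith [mul_nonneg hb.le (sq_nonneg k), sq_nonneg (a ^ 2)]
  calc y < 1 * (1 / (1 + c) * ellipticK (k ^ 2)) := by
        field_simp; linarith
    _ ≤ _ := by gcongr

end G

end

section

/-! ### Incomplete elliptic integrals and the amplitude -/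

/-- Reflection in π/2 and period π make the integral over 2π four times the quarter integral; this
is the source of the factors 4 in all periods. -/
lemma integral_add_mul_two_pi {h : ℝ → ℝ} (hc : Continuous h) (hp : Function.Periodic h π)
    (hs : ∀ x, h (π - x) = h x) (x : ℝ) (j : ℤ) :
    ∫ y in (0 : ℝ)..(x + j * (2 * π)), h y =
      (∫ y in (0 : ℝ)..x, h y) + j * (4 * ∫ y in (0 : ℝ)..(π / 2), h y) := by
  have hi (u v : ℝ) : IntervalIntegrable h volume u v := hc.intervalIntegrable u v
  have h1 : ∫ y in (π / 2)..π, h y = ∫ y in (0 : ℝ)..(π / 2), h y := by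
    have := intervalIntegral.integral_comp_sub_left (a := 0) (b := π / 2) h π
    simp only [hs, sub_zero] at this
    rw [this]; congr 1; ring
  have h2 : ∫ y in x..(x + π), h y = 2 * ∫ y in (0 : ℝ)..(π / 2), h y := by
    rw [hp.intervalIntegral_add_eq x 0, zero_add,
      ← intervalIntegral.integral_add_adjacent_intervals (hi 0 (π / 2)) (hi (π / 2) π), h1]
    ring
  have h3 := hp.intervalIntegral_add_zsmul_eq (2 * j) x hi
  rw [h2] at h3
  rw [← intervalIntegral.integral_add_adjacent_intervals (hi 0 x) (hi x _),
    show x + j * (2 * π) = x + (2 * j) • π by rw [zsmul_eq_mul]; push_cast; ring, h3, zsmul_eq_mul]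
  push_cast; ring

/-- The incomplete elliptic integral of the first kind. -/
def ellipticF (μ x : ℝ) : ℝ := ∫ θ in (0 : ℝ)..x, 1 / √(1 - μ * sin θ ^ 2)

lemma hasDerivAt_ellipticF {μ : ℝ} (h1 : μ < 1) (x : ℝ) :
    HasDerivAt (ellipticF μ) (1 / √(1 - μ * sin x ^ 2)) x :=
  (continuous_ellipticK_integrand h1).integral_hasStrictDerivAt 0 x |>.hasDerivAt

lemma ellipticF_add_mul_two_pi {μ : ℝ} (h1 : μ < 1) (x : ℝ) (j : ℤ) :
    ellipticF μ (x + j * (2 * π)) = ellipticF μ x + j * (4 * ellipticK μ) :=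
  integral_add_mul_two_pi (continuous_ellipticK_integrand h1) (fun x => by simp [sin_add_pi])
    (fun x => by simp [sin_pi_sub]) x j

lemma strictMono_ellipticF {μ : ℝ} (h1 : μ < 1) : StrictMono (ellipticF μ) :=
  strictMono_of_deriv_pos fun x => by
    rw [(hasDerivAt_ellipticF h1 x).deriv]
    exact one_div_pos.2 (sqrt_pos.2 (mul_sin_sq_lt_one h1 x))

lemma continuous_ellipticF {μ : ℝ} (h1 : μ < 1) : Continuous (ellipticF μ) :=
  continuous_iff_continuousAt.2 fun x => (hasDerivAt_ellipticF h1 x).continuousAt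

lemma surjective_ellipticF {μ : ℝ} (h1 : μ < 1) : Function.Surjective (ellipticF μ) := by
  have hK := ellipticK_pos h1
  intro y
  have h0 : ellipticF μ 0 = 0 := by simp [ellipticF]
  have hj (j : ℤ) : ellipticF μ (j * (2 * π)) = j * (4 * ellipticK μ) := by
    have := ellipticF_add_mul_two_pi h1 0 j
    rwa [h0, zero_add, zero_add] at this
  have hup := hj ⌈y / (4 * ellipticK μ)⌉
  have hlo := hj ⌊y / (4 * ellipticK μ)⌋
  have e1 := Int.le_ceil (y / (4 * ellipticK μ))
  have e2 := Int.floor_le (y / (4 * ellipticK μ))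
  rw [div_le_iff₀ (by positivity), ← hup] at e1
  rw [le_div_iff₀ (by positivity), ← hlo] at e2
  exact mem_range_of_exists_le_of_exists_ge (continuous_ellipticF h1) ⟨_, e2⟩ ⟨_, e1⟩

/-- The incomplete elliptic integral of the third kind. -/
def incompletePi (ν μ x : ℝ) : ℝ :=
  ∫ θ in (0 : ℝ)..x, 1 / ((1 + ν * sin θ ^ 2) * √(1 - μ * sin θ ^ 2))

lemma hasDerivAt_incompletePi {ν μ : ℝ} (hν : 0 ≤ ν) (h1 : μ < 1) (x : ℝ) :
    HasDerivAt (incompletePi ν μ) (1 / ((1 + ν * sin x ^ 2) * √(1 - μ * sin x ^ 2))) x :=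
  (continuous_ellipticPi_integrand hν h1).integral_hasStrictDerivAt 0 x |>.hasDerivAt

lemma incompletePi_add_mul_two_pi {ν μ : ℝ} (hν : 0 ≤ ν) (h1 : μ < 1) (x : ℝ) (j : ℤ) :
    incompletePi ν μ (x + j * (2 * π)) = incompletePi ν μ x + j * (4 * ellipticPi (-ν) μ) := by
  rw [ellipticPi_neg]
  exact integral_add_mul_two_pi (continuous_ellipticPi_integrand hν h1)
    (fun x => by simp [sin_add_pi]) (fun x => by simp [sin_pi_sub]) x j

/-- `φ` solves the equation `φ' = ω √(1 - μ sin² φ)` of the elliptic amplitude. -/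
def IsAmplitude (μ ω : ℝ) (φ : ℝ → ℝ) : Prop :=
  ∀ t, HasDerivAt φ (ω * √(1 - μ * sin (φ t) ^ 2)) t

/-- The equation is separable, so the solution is the inverse of F applied to an affine function of
time. -/
lemma exists_isAmplitude {μ : ℝ} (h1 : μ < 1) (ω x : ℝ) : ∃ φ, IsAmplitude μ ω φ ∧ φ 0 = x := by
  let e := (strictMono_ellipticF h1).orderIsoOfSurjective _ (surjective_ellipticF h1)
  have he (y : ℝ) : ellipticF μ (e.symm y) = y := e.apply_symm_apply y
  have hd (y : ℝ) : HasDerivAt e.symm (√(1 - μ * sin (e.symm y) ^ 2)) y := by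
    have h2 := sqrt_pos.2 (mul_sin_sq_lt_one h1 (e.symm y))
    have := HasDerivAt.of_local_left_inverse (f := ellipticF μ) (g := e.symm) (a := y)
      e.symm.continuous.continuousAt (hasDerivAt_ellipticF h1 _) (one_div_pos.2 h2).ne'
      (Filter.Eventually.of_forall he)
    simpa using this
  refine ⟨fun t => e.symm (ω * t + ellipticF μ x), fun t => ?_, ?_⟩
  · have h3 : HasDerivAt (fun t => ω * t + ellipticF μ x) ω t := by
      simpa using ((hasDerivAt_id t).const_mul ω).add_const (ellipticF μ x)
    exact ((hd _).comp t h3).congr_deriv (mul_comm _ _)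
  · simp only [mul_zero, zero_add]
    exact e.symm_apply_apply x

namespace IsAmplitude
variable {μ ω : ℝ} {φ ψ : ℝ → ℝ}

/-- F straightens the flow to uniform motion. The period of an amplitude and the time shift between
two amplitudes both follow from this and the injectivity of F. -/
lemma ellipticF_eq (h : IsAmplitude μ ω φ) (h1 : μ < 1) (t : ℝ) :
    ellipticF μ (φ t) = ellipticF μ (φ 0) + ω * t := by
  have hd (s : ℝ) : HasDerivAt (fun s => ellipticF μ (φ s) - ω * s) 0 s := by
    have h2 := sqrt_pos.2 (mul_sin_sq_lt_one h1 (φ s))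
    refine (((hasDerivAt_ellipticF h1 _).comp s (h s)).sub
      ((hasDerivAt_id s).const_mul ω)).congr_deriv ?_
    field_simp; ring
  have := is_const_of_deriv_eq_zero (fun s => (hd s).differentiableAt) (fun s => (hd s).deriv) t 0
  simp only [mul_zero, sub_zero] at this
  linarith

lemma add_period (h : IsAmplitude μ ω φ) (h1 : μ < 1) (hω : 0 < ω) (t : ℝ) (j : ℤ) :
    φ (t + j * (4 * ellipticK μ / ω)) = φ t + j * (2 * π) := by
  apply (strictMono_ellipticF h1).injective
  rw [ellipticF_add_mul_two_pi h1, h.ellipticF_eq h1, h.ellipticF_eq h1 t]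
  field_simp; ring

lemma eq_period (h : IsAmplitude μ ω φ) (h1 : μ < 1) (hω : 0 < ω) {L : ℝ} {j : ℤ}
    (hL : φ L = φ 0 + j * (2 * π)) : L = j * (4 * ellipticK μ / ω) := by
  have h2 := h.ellipticF_eq h1 L
  rw [hL, ellipticF_add_mul_two_pi h1] at h2
  field_simp; linarith

lemma exists_shift (h : IsAmplitude μ ω φ) (h' : IsAmplitude μ ω ψ) (h1 : μ < 1) (hω : 0 < ω) :
    ∃ t₀, ∀ t, ψ t = φ (t + t₀) := by
  refine ⟨(ellipticF μ (ψ 0) - ellipticF μ (φ 0)) / ω, fun t => ?_⟩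
  apply (strictMono_ellipticF h1).injective
  rw [h.ellipticF_eq h1, h'.ellipticF_eq h1]
  field_simp; ring

/-- The square root cancels against the speed of φ. What is left will be the precession rate, up to
a constant factor. -/
lemma hasDerivAt_incompletePi (h : IsAmplitude μ ω φ) {ν : ℝ} (hν : 0 ≤ ν) (h1 : μ < 1) (t : ℝ) :
    HasDerivAt (fun t => incompletePi ν μ (φ t)) (ω / (1 + ν * sin (φ t) ^ 2)) t := by
  have h2 := sqrt_pos.2 (mul_sin_sq_lt_one h1 (φ t))
  have h3 := one_add_mul_sin_sq_pos hν (φ t)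
  refine ((SRSO3.hasDerivAt_incompletePi hν h1 _).comp t (h t)).congr_deriv ?_
  generalize √(1 - μ * sin (φ t) ^ 2) = D at h2
  field_simp

end IsAmplitude

/-! ### The vertical part of the Hamiltonian system -/

/-- `p` solves the vertical part of the Hamiltonian system. -/
structure IsCostate (a : ℝ) (p : ℝ → Covector) : Prop where
  deriv_p₁ : ∀ t, HasDerivAt (fun τ => (p τ).p₁) ((p t).p₃ * (p t).p₂) t
  deriv_p₂ : ∀ t, HasDerivAt (fun τ => (p τ).p₂) (-((p t).p₃ * (p t).p₁)) t
  deriv_p₃ : ∀ t, HasDerivAt (fun τ => (p τ).p₃) (a ^ 2 * (p t).p₁ * (p t).p₂) t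

lemma IsExtremal.isCostate {a : ℝ} {R : ℝ → SO3} {p : ℝ → Covector} (h : IsExtremal a R p) :
    IsCostate a p := ⟨h.deriv_p₁, h.deriv_p₂, h.deriv_p₃⟩

namespace IsCostate
variable {a : ℝ} {p q : ℝ → Covector}

lemma sq_add_sq_eq (h : IsCostate a p) (t : ℝ) :
    (p t).p₁ ^ 2 + (p t).p₂ ^ 2 = (p 0).p₁ ^ 2 + (p 0).p₂ ^ 2 := by
  have hd (s : ℝ) : HasDerivAt (fun s => (p s).p₁ ^ 2 + (p s).p₂ ^ 2) 0 s := by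
    refine (((h.deriv_p₁ s).pow 2).add ((h.deriv_p₂ s).pow 2)).congr_deriv ?_
    norm_num; ring
  exact is_const_of_deriv_eq_zero (fun s => (hd s).differentiableAt) (fun s => (hd s).deriv) t 0

lemma energy_eq (h : IsCostate a p) (t : ℝ) : energy a (p t) = energy a (p 0) := by
  have hd (s : ℝ) : HasDerivAt (fun s => energy a (p s)) 0 s := by
    refine ((((h.deriv_p₃ s).pow 2).const_mul 2).sub
      ((((h.deriv_p₁ s).pow 2).sub ((h.deriv_p₂ s).pow 2)).const_mul (a ^ 2))).congr_deriv ?_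
    norm_num; ring
  exact is_const_of_deriv_eq_zero (fun s => (hd s).differentiableAt) (fun s => (hd s).deriv) t 0

lemma exists_bound (h : IsCostate a p) :
    ∃ B, ∀ t, |(p t).p₁| ≤ B ∧ |(p t).p₂| ≤ B ∧ |(p t).p₃| ≤ B := by
  set N := (p 0).p₁ ^ 2 + (p 0).p₂ ^ 2 with hN
  set E := energy a (p 0) with hE
  have hN0 : 0 ≤ N := by positivity
  refine ⟨√(N + |E| + a ^ 2 * N), fun t => ?_⟩
  have h1 := h.sq_add_sq_eq t
  have h2 := h.energy_eq t
  rw [← hN] at h1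
  rw [← hE, energy] at h2
  have h3 : 0 ≤ a ^ 2 * N := by positivity
  have h4 : a ^ 2 * ((p t).p₁ ^ 2 - (p t).p₂ ^ 2) ≤ a ^ 2 * N := by
    gcongr; nlinarith [sq_nonneg (p t).p₂]
  refine ⟨abs_le_sqrt ?_, abs_le_sqrt ?_, abs_le_sqrt ?_⟩ <;>
    nlinarith [sq_nonneg (p t).p₁, sq_nonneg (p t).p₂, sq_nonneg (p t).p₃, abs_nonneg E, le_abs_self E]

/-- The two conserved quantities keep both solutions in a ball, on which the polynomial vector field
is Lipschitz. -/
lemma eq_of_eq_zero (h : IsCostate a p) (h' : IsCostate a q) (h0 : p 0 = q 0) : p = q := by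
  obtain ⟨B, hB⟩ := h.exists_bound
  obtain ⟨B', hB'⟩ := h'.exists_bound
  let V : ℝ × ℝ × ℝ → ℝ × ℝ × ℝ := fun x => (x.2.2 * x.2.1, -(x.2.2 * x.1), a ^ 2 * x.1 * x.2.1)
  let s : Set (ℝ × ℝ × ℝ) := Metric.closedBall 0 (max B B')
  obtain ⟨K, hK⟩ : ∃ K, LipschitzOnWith K V s :=
    ContDiffOn.exists_lipschitzOnWith (n := 1) (ContDiff.contDiffOn (by fun_prop)) one_ne_zero
      (convex_closedBall _ _) (isCompact_closedBall _ _)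
  have key := ODE_solution_unique_univ (v := fun _ => V) (s := fun _ => s) (K := K) (t₀ := 0)
    (f := fun t => ((p t).p₁, (p t).p₂, (p t).p₃)) (g := fun t => ((q t).p₁, (q t).p₂, (q t).p₃))
    (fun _ => hK)
    (fun t => ⟨(h.deriv_p₁ t).prodMk ((h.deriv_p₂ t).prodMk (h.deriv_p₃ t)), by
      obtain ⟨h1, h2, h3⟩ := hB t
      simp [s, Prod.norm_def, h1, h2, h3]⟩)
    (fun t => ⟨(h'.deriv_p₁ t).prodMk ((h'.deriv_p₂ t).prodMk (h'.deriv_p₃ t)), by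
      obtain ⟨h1, h2, h3⟩ := hB' t
      simp [s, Prod.norm_def, h1, h2, h3]⟩)
    (by simp [h0])
  ext t
  · exact congrArg (fun x => x.1) (congrFun key t)
  · exact congrArg (fun x => x.2.1) (congrFun key t)
  · exact congrArg (fun x => x.2.2) (congrFun key t)

end IsCostate

/-! ### Explicit solutions of the vertical system -/

/-- The covectors of `C₁` with modulus `k`, in elliptic coordinates. -/
def oscillating (a k σ x : ℝ) : Covector :=
  ⟨σ * √(1 - k ^ 2 * sin x ^ 2), -(σ * (k * sin x)), a * k * cos x⟩

/-- The covectors of `C₂` with modulus `k`, in elliptic coordinates. -/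
def rotating (a k σ x : ℝ) : Covector :=
  ⟨cos x, -(σ * sin x), σ * (a / k * √(1 - k ^ 2 * sin x ^ 2))⟩

lemma hasDerivAt_delta {μ : ℝ} (h1 : μ < 1) {ω t : ℝ} {φ : ℝ → ℝ}
    (h : HasDerivAt φ (ω * √(1 - μ * sin (φ t) ^ 2)) t) :
    HasDerivAt (fun t => √(1 - μ * sin (φ t) ^ 2)) (-(ω * μ * sin (φ t) * cos (φ t))) t := by
  have h2 := mul_sin_sq_lt_one h1 (φ t)
  have h3 := sqrt_pos.2 h2
  have := ((((h.sin).pow 2).const_mul μ).const_sub 1).sqrt h2.ne'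
  refine this.congr_deriv ?_
  simp only [Pi.pow_apply]
  field_simp; norm_num; ring

lemma isCostate_oscillating {a k σ : ℝ} {φ : ℝ → ℝ} (hk : k ∈ Ioo (0 : ℝ) 1)
    (hσ : σ = 1 ∨ σ = -1) (h : IsAmplitude (k ^ 2) a φ) :
    IsCostate a fun t => oscillating a k σ (φ t) := by
  have h1 := (sq_mem_Ico ⟨hk.1.le, hk.2⟩).2
  have hσ2 : σ ^ 2 = 1 := by rcases hσ with rfl | rfl <;> norm_num
  refine ⟨fun t => ?_, fun t => ?_, fun t => ?_⟩
  · refine ((hasDerivAt_delta h1 (h t)).const_mul σ).congr_deriv ?_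
    simp only [oscillating]; ring
  · refine (((h t).sin.const_mul k).const_mul σ).neg.congr_deriv ?_
    simp only [oscillating]; ring
  · refine ((h t).cos.const_mul (a * k)).congr_deriv ?_
    simp only [oscillating]
    linear_combination (a ^ 2 * k * sin (φ t) * √(1 - k ^ 2 * sin (φ t) ^ 2)) * hσ2

lemma isCostate_rotating {a k σ : ℝ} {φ : ℝ → ℝ} (hk : k ∈ Ioo (0 : ℝ) 1)
    (hσ : σ = 1 ∨ σ = -1) (h : IsAmplitude (k ^ 2) (a / k) φ) :
    IsCostate a fun t => rotating a k σ (φ t) := by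
  have h1 := (sq_mem_Ico ⟨hk.1.le, hk.2⟩).2
  have hk0 := hk.1
  have hσ2 : σ ^ 2 = 1 := by rcases hσ with rfl | rfl <;> norm_num
  refine ⟨fun t => ?_, fun t => ?_, fun t => ?_⟩
  · refine (h t).cos.congr_deriv ?_
    simp only [rotating]
    linear_combination (a / k * sin (φ t) * √(1 - k ^ 2 * sin (φ t) ^ 2)) * hσ2
  · refine ((h t).sin.const_mul σ).neg.congr_deriv ?_
    simp only [rotating]; ring
  · refine (((hasDerivAt_delta h1 (h t)).const_mul (a / k)).const_mul σ).congr_deriv ?_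
    simp only [rotating]; field_simp

lemma exists_cos_sin_eq {x y : ℝ} (h : x ^ 2 + y ^ 2 = 1) : ∃ θ, cos θ = x ∧ sin θ = y := by
  have hn : ‖(⟨x, y⟩ : ℂ)‖ = 1 := by
    rw [Complex.norm_def, Complex.normSq_mk, sqrt_eq_one]; nlinarith
  have h0 : (⟨x, y⟩ : ℂ) ≠ 0 := by rw [← norm_pos_iff, hn]; exact one_pos
  exact ⟨Complex.arg ⟨x, y⟩, by rw [Complex.cos_arg h0, hn, div_one],
    by rw [Complex.sin_arg, hn, div_one]⟩

lemma exists_sign_mul_abs (x : ℝ) : ∃ σ : ℝ, (σ = 1 ∨ σ = -1) ∧ x = σ * |x| := by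
  rcases le_total 0 x with h | h
  · exact ⟨1, Or.inl rfl, by rw [abs_of_nonneg h, one_mul]⟩
  · exact ⟨-1, Or.inr rfl, by rw [abs_of_nonpos h]; ring⟩

/-- The energy relation reads a²k² = p₃² + a²p₂², so (p₃/(ak), -σp₂/k) lies on the unit circle and
gives the angle x. Here σ is the sign of p₁. -/
lemma exists_eq_oscillating {a : ℝ} (ha : 0 < a) {p : Covector} (hp : p ∈ C₁ a) :
    modulus₁ a p ∈ Ioo (0 : ℝ) 1 ∧
      ∃ σ x, (σ = 1 ∨ σ = -1) ∧ p = oscillating a (modulus₁ a p) σ x := by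
  obtain ⟨h1, hE1, hE2⟩ := hp
  set k := modulus₁ a p with hk
  have hk2 : k ^ 2 = (energy a p + a ^ 2) / (2 * a ^ 2) :=
    sq_sqrt (div_nonneg (by linarith) (by positivity))
  have hk0 : 0 < k := sqrt_pos.2 (div_pos (by linarith) (by positivity))
  have hk1 : k < 1 := by
    rw [hk, modulus₁, sqrt_lt' one_pos, one_pow, div_lt_one (by positivity)]; linarith
  refine ⟨⟨hk0, hk1⟩, ?_⟩
  have hid : a ^ 2 * k ^ 2 = p.p₃ ^ 2 + a ^ 2 * p.p₂ ^ 2 := by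
    rw [hk2, energy]; field_simp; linear_combination (-a ^ 2) * h1
  obtain ⟨σ, hσ, hp1⟩ := exists_sign_mul_abs p.p₁
  have hσ2 : σ ^ 2 = 1 := by rcases hσ with rfl | rfl <;> norm_num
  obtain ⟨x, hc, hs⟩ := exists_cos_sin_eq (x := p.p₃ / (a * k)) (y := -(σ * p.p₂) / k) (by
    field_simp; linear_combination a ^ 2 * p.p₂ ^ 2 * hσ2 - hid)
  refine ⟨σ, x, hσ, ?_⟩
  have hks : k * sin x = -(σ * p.p₂) := by rw [hs]; field_simp
  ext
  · simp only [oscillating]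
    rw [← mul_pow, hks, hp1]
    congr 1
    rw [← sqrt_sq_eq_abs p.p₁]
    congr 1
    linear_combination p.p₂ ^ 2 * hσ2 + h1
  · simp only [oscillating]; rw [hks]; linear_combination (-p.p₂) * hσ2
  · simp only [oscillating]; rw [hc]; field_simp

/-- Now the angle comes from (p₁, -σp₂) itself and σ is the sign of p₃; the energy relation a² =
k²(p₃² + a²p₂²) then gives |p₃|. -/
lemma exists_eq_rotating {a : ℝ} (ha : 0 < a) {p : Covector} (hp : p ∈ C₂ a) :
    modulus₂ a p ∈ Ioo (0 : ℝ) 1 ∧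
      ∃ σ x, (σ = 1 ∨ σ = -1) ∧ p = rotating a (modulus₂ a p) σ x := by
  obtain ⟨h1, hE⟩ := hp
  replace hE : a ^ 2 < energy a p := hE
  have ha2 : 0 < a ^ 2 := by positivity
  set k := modulus₂ a p with hk
  have hE' : 0 < energy a p + a ^ 2 := by linarith
  have hk2 : k ^ 2 = 2 * a ^ 2 / (energy a p + a ^ 2) := sq_sqrt (by positivity)
  have hk0 : 0 < k := sqrt_pos.2 (by positivity)
  have hk1 : k < 1 := by
    rw [hk, modulus₂, sqrt_lt' one_pos, one_pow, div_lt_one (by positivity)]; linarith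
  refine ⟨⟨hk0, hk1⟩, ?_⟩
  have hid : a ^ 2 = k ^ 2 * (p.p₃ ^ 2 + a ^ 2 * p.p₂ ^ 2) := by
    have : p.p₃ ^ 2 + a ^ 2 * p.p₂ ^ 2 = (energy a p + a ^ 2) / 2 := by
      rw [energy]; linear_combination (a ^ 2 / 2) * h1
    rw [hk2, this]; field_simp
  obtain ⟨σ, hσ, hp3⟩ := exists_sign_mul_abs p.p₃
  have hσ2 : σ ^ 2 = 1 := by rcases hσ with rfl | rfl <;> norm_num
  obtain ⟨x, hc, hs⟩ := exists_cos_sin_eq (x := p.p₁) (y := -(σ * p.p₂)) (by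
    linear_combination p.p₂ ^ 2 * hσ2 + h1)
  refine ⟨σ, x, hσ, ?_⟩
  ext
  · simp only [rotating]; rw [hc]
  · simp only [rotating]; rw [hs]; linear_combination (-p.p₂) * hσ2
  · simp only [rotating]
    rw [hs]
    have h3 : a / k * √(1 - k ^ 2 * (-(σ * p.p₂)) ^ 2) = |p.p₃| := by
      rw [← sqrt_sq (show 0 ≤ a / k by positivity), ← sqrt_mul (sq_nonneg _), ← sqrt_sq_eq_abs]
      congr 1
      field_simp
      linear_combination hid - a ^ 2 * k ^ 2 * p.p₂ ^ 2 * hσ2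
    rw [h3, ← hp3]

lemma oscillating_mem {a k σ : ℝ} (ha : 0 < a) (hk : k ∈ Ioo (0 : ℝ) 1) (hσ : σ = 1 ∨ σ = -1)
    (x : ℝ) : oscillating a k σ x ∈ C₁ a ∧ modulus₁ a (oscillating a k σ x) = k := by
  have h2 := sq_sqrt (mul_sin_sq_lt_one (sq_mem_Ico ⟨hk.1.le, hk.2⟩).2 x).le
  have hσ2 : σ ^ 2 = 1 := by rcases hσ with rfl | rfl <;> norm_num
  have h3 : (σ * √(1 - k ^ 2 * sin x ^ 2)) ^ 2 = 1 - k ^ 2 * sin x ^ 2 := by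
    rw [mul_pow, h2, hσ2, one_mul]
  have h4 : (-(σ * (k * sin x))) ^ 2 = k ^ 2 * sin x ^ 2 := by
    linear_combination k ^ 2 * sin x ^ 2 * hσ2
  have hE : energy a (oscillating a k σ x) = a ^ 2 * (2 * k ^ 2 - 1) := by
    simp only [energy, oscillating]
    rw [h3, h4]
    linear_combination 2 * a ^ 2 * k ^ 2 * sin_sq_add_cos_sq x
  have ha2 : 0 < a ^ 2 := by positivity
  have hk0 := hk.1
  have hk2 : 0 < k ^ 2 := by positivity
  have hk1 : k ^ 2 < 1 := by nlinarith [hk.2]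
  refine ⟨⟨?_, ?_, ?_⟩, ?_⟩
  · simp only [oscillating]; rw [h3, h4]; ring
  · rw [hE]; nlinarith
  · rw [hE]; nlinarith
  · rw [modulus₁, hE, ← sqrt_sq hk.1.le]
    congr 1; rw [sqrt_sq hk.1.le]; field_simp; ring

lemma rotating_mem {a k σ : ℝ} (ha : 0 < a) (hk : k ∈ Ioo (0 : ℝ) 1) (hσ : σ = 1 ∨ σ = -1)
    (x : ℝ) : rotating a k σ x ∈ C₂ a ∧ modulus₂ a (rotating a k σ x) = k := by
  have h2 := sq_sqrt (mul_sin_sq_lt_one (sq_mem_Ico ⟨hk.1.le, hk.2⟩).2 x).le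
  have hσ2 : σ ^ 2 = 1 := by rcases hσ with rfl | rfl <;> norm_num
  have hk0 := hk.1
  have h3 : (σ * (a / k * √(1 - k ^ 2 * sin x ^ 2))) ^ 2 = a ^ 2 / k ^ 2 - a ^ 2 * sin x ^ 2 := by
    rw [mul_pow, mul_pow, h2, hσ2]; field_simp
  have h4 : (-(σ * sin x)) ^ 2 = sin x ^ 2 := by
    linear_combination sin x ^ 2 * hσ2
  have hE : energy a (rotating a k σ x) = a ^ 2 * (2 / k ^ 2 - 1) := by
    simp only [energy, rotating]
    rw [h3, h4]
    linear_combination -a ^ 2 * sin_sq_add_cos_sq x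
  have ha2 : 0 < a ^ 2 := by positivity
  have hk2 : 0 < k ^ 2 := by positivity
  have hk1 : k ^ 2 < 1 := by nlinarith [hk.2]
  have hk3 : 1 < 1 / k ^ 2 := by rwa [lt_div_iff₀ hk2, one_mul]
  refine ⟨⟨?_, ?_⟩, ?_⟩
  · simp only [rotating]; rw [h4]; linear_combination sin_sq_add_cos_sq x
  · rw [hE, mem_Ioi, show (2:ℝ) / k ^ 2 = 2 * (1 / k ^ 2) by ring]; nlinarith
  · rw [modulus₂, hE, ← sqrt_sq hk.1.le]
    congr 1; rw [sqrt_sq hk.1.le]; field_simp; ring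

lemma IsCostate.eq_oscillating {a : ℝ} (ha : 0 < a) {p : ℝ → Covector} (h : IsCostate a p)
    (hp : p 0 ∈ C₁ a) : ∃ σ φ, (σ = 1 ∨ σ = -1) ∧ IsAmplitude (modulus₁ a (p 0) ^ 2) a φ ∧
      ∀ t, p t = oscillating a (modulus₁ a (p 0)) σ (φ t) := by
  obtain ⟨hk, σ, x, hσ, hx⟩ := exists_eq_oscillating ha hp
  obtain ⟨φ, hφ, h0⟩ := exists_isAmplitude (sq_mem_Ico ⟨hk.1.le, hk.2⟩).2 a x
  exact ⟨σ, φ, hσ, hφ, congrFun <| h.eq_of_eq_zero (isCostate_oscillating hk hσ hφ)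
    (by simp only [h0]; exact hx)⟩

lemma IsCostate.eq_rotating {a : ℝ} (ha : 0 < a) {p : ℝ → Covector} (h : IsCostate a p)
    (hp : p 0 ∈ C₂ a) : ∃ σ φ, (σ = 1 ∨ σ = -1) ∧
      IsAmplitude (modulus₂ a (p 0) ^ 2) (a / modulus₂ a (p 0)) φ ∧
      ∀ t, p t = rotating a (modulus₂ a (p 0)) σ (φ t) := by
  obtain ⟨hk, σ, x, hσ, hx⟩ := exists_eq_rotating ha hp
  obtain ⟨φ, hφ, h0⟩ := exists_isAmplitude (sq_mem_Ico ⟨hk.1.le, hk.2⟩).2 (a / modulus₂ a (p 0)) x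
  exact ⟨σ, φ, hσ, hφ, congrFun <| h.eq_of_eq_zero (isCostate_rotating hk hσ hφ)
    (by simp only [h0]; exact hx)⟩

end

section

/-! ### Entrywise differentiation of matrix curves -/

/-- The matrix curve `Y` has the entrywise derivative `Y'` at `t`. -/
def HasEntryDerivAt (Y : ℝ → Matrix (Fin 3) (Fin 3) ℝ) (Y' : Matrix (Fin 3) (Fin 3) ℝ) (t : ℝ) :
    Prop :=
  ∀ i j, HasDerivAt (fun τ => Y τ i j) (Y' i j) t

namespace HasEntryDerivAt
variable {Y Z : ℝ → Matrix (Fin 3) (Fin 3) ℝ} {Y' Z' : Matrix (Fin 3) (Fin 3) ℝ} {t : ℝ}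

lemma mul (hY : HasEntryDerivAt Y Y' t) (hZ : HasEntryDerivAt Z Z' t) :
    HasEntryDerivAt (fun τ => Y τ * Z τ) (Y' * Z t + Y t * Z') t := by
  intro i j
  simp only [Matrix.mul_apply, Matrix.add_apply, ← Finset.sum_add_distrib]
  exact HasDerivAt.fun_sum fun k _ => (hY i k).mul (hZ k j)

lemma transpose (hY : HasEntryDerivAt Y Y' t) : HasEntryDerivAt (fun τ => (Y τ).transpose)
    Y'.transpose t := fun i j => hY j i

lemma const (A : Matrix (Fin 3) (Fin 3) ℝ) (t : ℝ) : HasEntryDerivAt (fun _ => A) 0 t :=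
  fun i j => hasDerivAt_const t (A i j)

lemma congr_deriv (hY : HasEntryDerivAt Y Y' t) (h : Y' = Z') : HasEntryDerivAt Y Z' t := h ▸ hY

lemma const_mul (A : Matrix (Fin 3) (Fin 3) ℝ) (hY : HasEntryDerivAt Y Y' t) :
    HasEntryDerivAt (fun τ => A * Y τ) (A * Y') t :=
  ((const A t).mul hY).congr_deriv (by simp)

lemma mul_const (hY : HasEntryDerivAt Y Y' t) (A : Matrix (Fin 3) (Fin 3) ℝ) :
    HasEntryDerivAt (fun τ => Y τ * A) (Y' * A) t :=
  (hY.mul (const A t)).congr_deriv (by simp)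

lemma shift {t₀ : ℝ} (hY : HasEntryDerivAt Y Y' (t + t₀)) :
    HasEntryDerivAt (fun τ => Y (τ + t₀)) Y' t :=
  fun i j => (hY i j).comp_add_const t t₀

lemma unique (hY : HasEntryDerivAt Y Y' t) (hZ : HasEntryDerivAt Y Z' t) : Y' = Z' := by
  ext i j; exact (hY i j).unique (hZ i j)

end HasEntryDerivAt

lemma eq_of_hasEntryDerivAt_zero {Y : ℝ → Matrix (Fin 3) (Fin 3) ℝ}
    (h : ∀ t, HasEntryDerivAt Y 0 t) (s t : ℝ) : Y s = Y t := by
  ext i j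
  exact is_const_of_deriv_eq_zero (fun s => (h s i j).differentiableAt)
    (fun s => (h s i j).deriv) s t

/-! ### Horizontal velocities -/

/-- The velocity `u₁ X₁ + u₂ X₂` at the identity. -/
def velocity (a u₁ u₂ : ℝ) : Matrix (Fin 3) (Fin 3) ℝ := u₁ • X₁ + u₂ • X₂ a

lemma velocity_eq (a u₁ u₂ : ℝ) : velocity a u₁ u₂ =
    !![0, 0, u₁; 0, 0, -(√(1 - a ^ 2) * u₂); -u₁, √(1 - a ^ 2) * u₂, 0] := by
  ext i j
  fin_cases i <;> fin_cases j <;> simp [velocity, X₁, X₂, A₁, A₂, mul_comm]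

lemma velocity_transpose (a u₁ u₂ : ℝ) :
    (velocity a u₁ u₂).transpose = -velocity a u₁ u₂ := by
  ext i j
  fin_cases i <;> fin_cases j <;> simp [velocity_eq]

lemma hasVelocityAt_iff {a : ℝ} {R : ℝ → SO3} {u₁ u₂ t : ℝ} : HasVelocityAt a R u₁ u₂ t ↔
    HasEntryDerivAt (fun τ => (R τ).1) ((R t).1 * velocity a u₁ u₂) t := Iff.rfl

lemma SO3.mul_transpose (R : SO3) : R.1 * R.1.transpose = 1 :=
  (Matrix.mem_orthogonalGroup_iff (Fin 3) ℝ).1 (Matrix.mem_specialOrthogonalGroup_iff.1 R.2).1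

lemma SO3.transpose_mul (R : SO3) : R.1.transpose * R.1 = 1 :=
  (Matrix.mem_orthogonalGroup_iff' (Fin 3) ℝ).1 (Matrix.mem_specialOrthogonalGroup_iff.1 R.2).1

lemma SO3.coe_inv (R : SO3) : (R⁻¹).1 = R.1.transpose := by
  have h : (R⁻¹).1 * R.1 = 1 := by
    rw [← Submonoid.coe_mul, inv_mul_cancel]; rfl
  calc (R⁻¹).1 = (R⁻¹).1 * (R.1 * R.1.transpose) := by rw [SO3.mul_transpose, mul_one]
    _ = R.1.transpose := by rw [← mul_assoc, h, one_mul]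

/-- The element of `SO(3)` given by a matrix. -/
def SO3.mk (A : Matrix (Fin 3) (Fin 3) ℝ) (h : A * A.transpose = 1) (hd : A.det = 1) : SO3 :=
  ⟨A, Matrix.mem_specialOrthogonalGroup_iff.2 ⟨(Matrix.mem_orthogonalGroup_iff (Fin 3) ℝ).2 h, hd⟩⟩

/-- A curve of matrices with the same controls as a curve in `SO(3)` is a left translate of it. -/
lemma eq_mul_of_same_velocity {a : ℝ} {R : ℝ → SO3} {Y : ℝ → Matrix (Fin 3) (Fin 3) ℝ}
    {u : ℝ → ℝ × ℝ} (hR : ∀ t, HasVelocityAt a R (u t).1 (u t).2 t)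
    (hY : ∀ t, HasEntryDerivAt Y (Y t * velocity a (u t).1 (u t).2) t) (s t : ℝ) :
    Y t = Y s * (R s).1.transpose * (R t).1 := by
  have h := eq_of_hasEntryDerivAt_zero (Y := fun τ => Y τ * (R τ).1.transpose)
    (fun τ => ((hY τ).mul (hasVelocityAt_iff.1 (hR τ)).transpose).congr_deriv (by
      rw [Matrix.transpose_mul, velocity_transpose, mul_assoc, neg_mul, mul_neg,
        add_neg_cancel])) t s
  rw [← h, mul_assoc, SO3.transpose_mul, mul_one]

lemma velocity_injective {a u₁ u₂ v₁ v₂ : ℝ} (ha : a ∈ Ioo (0 : ℝ) 1)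
    (h : velocity a u₁ u₂ = velocity a v₁ v₂) : u₁ = v₁ ∧ u₂ = v₂ := by
  have hb := (sqrt_pos.2 (one_sub_sq_pos ha)).ne'
  have h1 := congrFun (congrFun h 0) 2
  have h2 := congrFun (congrFun h 2) 1
  simp [velocity_eq, hb] at h1 h2
  exact ⟨h1, h2⟩

/-! ### Congruent extremals -/

lemma diag_sq {S : SO3} (hS : S.1.IsDiag) (i : Fin 3) : S.1 i i ^ 2 = 1 := by
  have h := congrFun (congrFun (SO3.mul_transpose S) i) i
  rw [Matrix.mul_apply, Finset.sum_eq_single i (fun j _ hj => by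
    simp [hS hj.symm]) (by simp)] at h
  rw [sq]; simpa using h

lemma diag_conj_velocity {S : SO3} (hS : S.1.IsDiag) (a u₁ u₂ : ℝ) :
    S.1 * velocity a u₁ u₂ * S.1.transpose =
      velocity a (S.1 0 0 * S.1 2 2 * u₁) (S.1 1 1 * S.1 2 2 * u₂) := by
  have h01 : S.1 0 1 = 0 := hS (by decide)
  have h02 : S.1 0 2 = 0 := hS (by decide)
  have h10 : S.1 1 0 = 0 := hS (by decide)
  have h12 : S.1 1 2 = 0 := hS (by decide)
  have h20 : S.1 2 0 = 0 := hS (by decide)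
  have h21 : S.1 2 1 = 0 := hS (by decide)
  ext i j
  fin_cases i <;> fin_cases j <;>
    simp [velocity_eq, Matrix.mul_apply, Fin.sum_univ_three, h01, h02, h10, h12, h20, h21] <;> ring

lemma hasEntryDerivAt_conj {a : ℝ} {R : ℝ → SO3} {u₁ u₂ t t₀ : ℝ} {S : SO3} (hS : S.1.IsDiag)
    (A : Matrix (Fin 3) (Fin 3) ℝ) (h : HasVelocityAt a R u₁ u₂ (t + t₀)) :
    HasEntryDerivAt (fun τ => A * (S.1 * (R (τ + t₀)).1 * S.1.transpose))
      (A * (S.1 * (R (t + t₀)).1 * S.1.transpose) *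
        velocity a (S.1 0 0 * S.1 2 2 * u₁) (S.1 1 1 * S.1 2 2 * u₂)) t := by
  have h1 := (((hasVelocityAt_iff.1 h).shift.const_mul S.1).mul_const S.1.transpose).const_mul A
  refine h1.congr_deriv ?_
  rw [← diag_conj_velocity hS]
  have h2 := SO3.transpose_mul S
  calc _ = A * (S.1 * ((R (t + t₀)).1 * 1 * velocity a u₁ u₂) * S.1.transpose) := by
        rw [mul_one]
    _ = _ := by rw [← h2]; simp only [mul_assoc]

/-- Conjugating by S changes the signs of the controls, so the conjugated and shifted curve has the
controls of Q and can differ from Q only by a left translation. -/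
lemma congruent_of_controls {a : ℝ} {R Q : ℝ → SO3} {p q : ℝ → Covector}
    (hR : IsExtremal a R p) (hQ : IsExtremal a Q q) {S : SO3} (hS : S.1.IsDiag) {t₀ : ℝ}
    (h₁ : ∀ t, (q t).p₁ = S.1 0 0 * S.1 2 2 * (p (t + t₀)).p₁)
    (h₂ : ∀ t, (q t).p₂ = S.1 1 1 * S.1 2 2 * (p (t + t₀)).p₂) : Congruent R Q := by
  let P : ℝ → SO3 := fun t => S * R (t + t₀) * S⁻¹
  have hP (t : ℝ) : (P t).1 = S.1 * (R (t + t₀)).1 * S.1.transpose := by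
    simp only [P, Submonoid.coe_mul, SO3.coe_inv]
  have hPv (t : ℝ) : HasVelocityAt a P (q t).p₁ (q t).p₂ t := by
    have := hasEntryDerivAt_conj hS 1 (hR.horizontal (t + t₀))
    rw [← h₁, ← h₂] at this
    rw [hasVelocityAt_iff]
    simpa only [hP, one_mul] using this
  refine ⟨Q 0 * (P 0)⁻¹, S, t₀, hS, fun t => ?_⟩
  have := eq_mul_of_same_velocity (u := fun t => ((q t).p₁, (q t).p₂)) hPv
    (fun t => hasVelocityAt_iff.1 (hQ.horizontal t)) 0 t
  apply Subtype.ext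
  change (Q t).1 = (Q 0).1 * ((P 0)⁻¹).1 * (P t).1
  rw [this, SO3.coe_inv]

/-- p₃ is the angular velocity of the unit vector (p₁, p₂), up to sign. The controls alone therefore
determine the whole covector. -/
lemma IsCostate.p₃_eq {a : ℝ} {p : ℝ → Covector} (h0 : (p 0).p₁ ^ 2 + (p 0).p₂ ^ 2 = 1)
    (h : IsCostate a p) (t : ℝ) : (p t).p₃ =
      deriv (fun τ => (p τ).p₁) t * (p t).p₂ - deriv (fun τ => (p τ).p₂) t * (p t).p₁ := by
  rw [(h.deriv_p₁ t).deriv, (h.deriv_p₂ t).deriv]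
  have := h.sq_add_sq_eq t
  rw [h0] at this
  linear_combination (-(p t).p₃) * this

lemma controls_of_congruent {a : ℝ} (ha : a ∈ Ioo (0 : ℝ) 1) {R Q : ℝ → SO3} {p q : ℝ → Covector}
    (hR : IsExtremal a R p) (hQ : IsExtremal a Q q) (hp : (p 0).p₁ ^ 2 + (p 0).p₂ ^ 2 = 1)
    (hq : (q 0).p₁ ^ 2 + (q 0).p₂ ^ 2 = 1) {g S : SO3} (hS : S.1.IsDiag) {t₀ : ℝ}
    (h : ∀ t, Q t = g * (S * R (t + t₀) * S⁻¹)) (t : ℝ) :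
    (q t).p₁ = S.1 0 0 * S.1 2 2 * (p (t + t₀)).p₁ ∧
    (q t).p₂ = S.1 1 1 * S.1 2 2 * (p (t + t₀)).p₂ ∧
    (q t).p₃ = S.1 0 0 * S.1 1 1 * (p (t + t₀)).p₃ := by
  have hQ' (t : ℝ) : (Q t).1 = g.1 * (S.1 * (R (t + t₀)).1 * S.1.transpose) := by
    rw [h t, Submonoid.coe_mul, Submonoid.coe_mul, Submonoid.coe_mul, SO3.coe_inv]
  have hv (t : ℝ) : (q t).p₁ = S.1 0 0 * S.1 2 2 * (p (t + t₀)).p₁ ∧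
      (q t).p₂ = S.1 1 1 * S.1 2 2 * (p (t + t₀)).p₂ := by
    have h1 := hasVelocityAt_iff.1 (hQ.horizontal t)
    have h2 := hasEntryDerivAt_conj hS g.1 (hR.horizontal (t + t₀))
    simp only [← hQ'] at h2
    have h3 := congrArg ((Q t).1.transpose * ·) (h1.unique h2)
    simp only [← mul_assoc, SO3.transpose_mul, one_mul] at h3
    exact velocity_injective ha h3
  refine ⟨(hv t).1, (hv t).2, ?_⟩
  have e1 : (fun τ => (q τ).p₁) = fun τ => S.1 0 0 * S.1 2 2 * (p (τ + t₀)).p₁ :=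
    funext fun τ => (hv τ).1
  have e2 : (fun τ => (q τ).p₂) = fun τ => S.1 1 1 * S.1 2 2 * (p (τ + t₀)).p₂ :=
    funext fun τ => (hv τ).2
  rw [hQ.isCostate.p₃_eq hq t, e1, e2, (hv t).1, (hv t).2,
    (((hR.deriv_p₁ (t + t₀)).comp_add_const t t₀).const_mul _).deriv,
    (((hR.deriv_p₂ (t + t₀)).comp_add_const t t₀).const_mul _).deriv]
  have h4 := hR.isCostate.sq_add_sq_eq (t + t₀)
  rw [hp] at h4
  linear_combination S.1 0 0 * S.1 1 1 * S.1 2 2 ^ 2 * (p (t + t₀)).p₃ * h4 +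
    S.1 0 0 * S.1 1 1 * (p (t + t₀)).p₃ * diag_sq hS 2

/-- The energy involves only squares of the coordinates, so the signs introduced by S do not matter.
-/
lemma energy_eq_of_congruent {a : ℝ} (ha : a ∈ Ioo (0 : ℝ) 1) {R Q : ℝ → SO3} {p q : ℝ → Covector}
    (hR : IsExtremal a R p) (hQ : IsExtremal a Q q) (hp : (p 0).p₁ ^ 2 + (p 0).p₂ ^ 2 = 1)
    (hq : (q 0).p₁ ^ 2 + (q 0).p₂ ^ 2 = 1) (h : Congruent R Q) :
    energy a (q 0) = energy a (p 0) := by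
  obtain ⟨g, S, t₀, hS, h⟩ := h
  obtain ⟨h1, h2, h3⟩ := controls_of_congruent ha hR hQ hp hq hS h 0
  rw [← hR.isCostate.energy_eq (0 + t₀), energy, energy, h1, h2, h3]
  simp only [mul_pow, diag_sq hS, one_mul]

/-- A period of R is a congruence of R with itself by a pure time shift. -/
lemma IsExtremal.periodic_costate {a : ℝ} (ha : a ∈ Ioo (0 : ℝ) 1) {R : ℝ → SO3}
    {p : ℝ → Covector} (hR : IsExtremal a R p) (hp : (p 0).p₁ ^ 2 + (p 0).p₂ ^ 2 = 1) {L : ℝ}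
    (hL : Function.Periodic R L) : Function.Periodic p L := by
  intro t
  obtain ⟨h1, h2, h3⟩ := controls_of_congruent (g := 1) (S := 1) (t₀ := L) ha hR hR hp hp
    Matrix.isDiag_one (fun t => by simp [hL t]) t
  ext
  · simpa using h1.symm
  · simpa using h2.symm
  · simpa using h3.symm

end

section

/-! ### The frame adapted to the momentum -/

/-- The rotation by `θ` about the third axis. -/
def rotZ (θ : ℝ) : Matrix (Fin 3) (Fin 3) ℝ :=
  !![cos θ, -sin θ, 0; sin θ, cos θ, 0; 0, 0, 1]

/-- The length of the projection of the angular momentum to the plane of the first two axes. -/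
def planarMoment (b : ℝ) (p : Covector) : ℝ := √(p.p₁ ^ 2 + p.p₂ ^ 2 / b ^ 2)

/-- The rotation whose last row is the direction of the angular momentum `(p₂ / b, p₁, p₃ / b)`, of
length `m`, and whose first row is perpendicular to it and to the third axis. -/
def momentFrame (b m : ℝ) (p : Covector) : Matrix (Fin 3) (Fin 3) ℝ :=
  !![-(p.p₁ / planarMoment b p), p.p₂ / (b * planarMoment b p), 0;
    -(p.p₃ * p.p₂ / (b ^ 2 * m * planarMoment b p)), -(p.p₃ * p.p₁ / (b * m * planarMoment b p)),
      planarMoment b p / m;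
    p.p₂ / (b * m), p.p₁ / m, p.p₃ / (b * m)]

lemma rotZ_mul_transpose (θ : ℝ) : rotZ θ * (rotZ θ).transpose = 1 := by
  have := sin_sq_add_cos_sq θ
  ext i j
  fin_cases i <;> fin_cases j <;>
    simp [rotZ, Matrix.mul_apply, Fin.sum_univ_three] <;> grind

lemma det_rotZ (θ : ℝ) : (rotZ θ).det = 1 := by
  simp [rotZ, Matrix.det_fin_three]; linear_combination sin_sq_add_cos_sq θ

variable {b m : ℝ} {p : Covector}

lemma planarMoment_pos (hb : 0 < b) (hp : p.p₁ ^ 2 + p.p₂ ^ 2 = 1) : 0 < planarMoment b p := by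
  apply sqrt_pos.2
  rcases eq_or_ne p.p₂ 0 with h | h
  · rw [h] at hp ⊢; norm_num at hp ⊢; rcases hp with h | h <;> rw [h] <;> norm_num
  · positivity

lemma planarMoment_sq (hb : 0 < b) (p : Covector) :
    b ^ 2 * planarMoment b p ^ 2 = b ^ 2 * p.p₁ ^ 2 + p.p₂ ^ 2 := by
  rw [planarMoment, sq_sqrt (by positivity)]; field_simp

lemma momentFrame_mul_transpose (hb : 0 < b) (hm : 0 < m) (hp : p.p₁ ^ 2 + p.p₂ ^ 2 = 1)
    (hmb : m ^ 2 * b ^ 2 = b ^ 2 * p.p₁ ^ 2 + p.p₂ ^ 2 + p.p₃ ^ 2) :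
    momentFrame b m p * (momentFrame b m p).transpose = 1 := by
  have hs := planarMoment_pos hb hp
  have hs2 := planarMoment_sq hb p
  simp only [momentFrame]
  generalize planarMoment b p = s at hs hs2
  ext i j
  fin_cases i <;> fin_cases j <;>
    simp [Matrix.mul_apply, Fin.sum_univ_three] <;> field_simp <;> grind

lemma det_momentFrame (hb : 0 < b) (hm : 0 < m) (hp : p.p₁ ^ 2 + p.p₂ ^ 2 = 1)
    (hmb : m ^ 2 * b ^ 2 = b ^ 2 * p.p₁ ^ 2 + p.p₂ ^ 2 + p.p₃ ^ 2) :
    (momentFrame b m p).det = 1 := by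
  have hs := planarMoment_pos hb hp
  have hs2 := planarMoment_sq hb p
  simp only [momentFrame]
  generalize planarMoment b p = s at hs hs2
  simp [Matrix.det_fin_three]
  field_simp
  grind

lemma hasDerivAt_rotZ {θ : ℝ → ℝ} {θ' t : ℝ} (h : HasDerivAt θ θ' t) :
    HasEntryDerivAt (fun τ => rotZ (θ τ))
      (θ' • (rotZ (θ t) * !![0, -1, 0; 1, 0, 0; 0, 0, 0])) t := by
  intro i j
  fin_cases i <;> fin_cases j <;>
    simp [rotZ, hasDerivAt_const]
  · exact h.cos.congr_deriv (by ring)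
  · exact h.sin.neg.congr_deriv (by ring)
  · exact h.sin.congr_deriv (by ring)
  · exact h.cos.congr_deriv (by ring)

section
variable {a : ℝ} {p : ℝ → Covector}

lemma hasDerivAt_planarMoment (ha : a ∈ Ioo (0 : ℝ) 1) (h : IsCostate a p)
    (hp : ∀ t, (p t).p₁ ^ 2 + (p t).p₂ ^ 2 = 1) (t : ℝ) :
    HasDerivAt (fun t => planarMoment √(1 - a ^ 2) (p t))
      (-(a ^ 2 * (p t).p₁ * (p t).p₂ * (p t).p₃) / (√(1 - a ^ 2) ^ 2 *
        planarMoment √(1 - a ^ 2) (p t))) t := by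
  have hb := sqrt_pos.2 (one_sub_sq_pos ha)
  have hb2 := sq_sqrt (one_sub_sq_pos ha).le
  have hs := planarMoment_pos hb (hp t)
  have hs' := sqrt_pos.1 hs
  refine ((((h.deriv_p₁ t).pow 2).add (((h.deriv_p₂ t).pow 2).div_const _)).sqrt
    hs'.ne').congr_deriv ?_
  change _ / (2 * planarMoment √(1 - a ^ 2) (p t)) = _
  generalize planarMoment √(1 - a ^ 2) (p t) = s at hs
  generalize √(1 - a ^ 2) = b at hb hb2
  field_simp
  norm_num
  linear_combination 2 * (p t).p₁ * (p t).p₂ * (p t).p₃ * hb2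

/-- The last row is the momentum direction, which is fixed in space, so it moves with the body
velocity alone. The other two rows also turn about it, at rate m/s²; a rotation about the third axis
at that rate removes the extra term. -/
lemma hasDerivAt_momentFrame (ha : a ∈ Ioo (0 : ℝ) 1) (h : IsCostate a p)
    (hp : ∀ t, (p t).p₁ ^ 2 + (p t).p₂ ^ 2 = 1) {m : ℝ} (hm : 0 < m)
    (hmb : ∀ t, m ^ 2 * √(1 - a ^ 2) ^ 2 =
      √(1 - a ^ 2) ^ 2 * (p t).p₁ ^ 2 + (p t).p₂ ^ 2 + (p t).p₃ ^ 2) (t : ℝ) :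
    HasEntryDerivAt (fun t => momentFrame √(1 - a ^ 2) m (p t))
      (momentFrame √(1 - a ^ 2) m (p t) * velocity a (p t).p₁ (p t).p₂ -
        (m / planarMoment √(1 - a ^ 2) (p t) ^ 2) •
          (!![0, -1, 0; 1, 0, 0; 0, 0, 0] * momentFrame √(1 - a ^ 2) m (p t))) t := by
  have hb := sqrt_pos.2 (one_sub_sq_pos ha)
  have hb2 := sq_sqrt (one_sub_sq_pos ha).le
  have hs := planarMoment_pos hb (hp t)
  have hs2 := planarMoment_sq hb (p t)
  have hpt := hp t
  have hmt := hmb t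
  have hds := hasDerivAt_planarMoment ha h hp t
  have h1 := h.deriv_p₁ t
  have h2 := h.deriv_p₂ t
  have h3 := h.deriv_p₃ t
  have hs0 := hs.ne'
  intro i j
  rw [velocity_eq]
  fin_cases i <;> fin_cases j <;>
    simp [momentFrame]
  · refine (h1.div hds hs0).neg.congr_deriv ?_
    generalize planarMoment √(1 - a ^ 2) (p t) = s at *
    generalize √(1 - a ^ 2) = b at *
    field_simp
    grind
  · refine (h2.div (hds.const_mul _) (mul_pos hb hs).ne').congr_deriv ?_
    generalize planarMoment √(1 - a ^ 2) (p t) = s at *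
    generalize √(1 - a ^ 2) = b at *
    field_simp
    grind
  · refine (hasDerivAt_const t 0).congr_deriv ?_
    generalize planarMoment √(1 - a ^ 2) (p t) = s at *
    generalize √(1 - a ^ 2) = b at *
    field_simp
    grind
  · refine ((h3.mul h2).div (hds.const_mul _) (by positivity)).neg.congr_deriv ?_
    simp only [Pi.mul_apply]
    generalize planarMoment √(1 - a ^ 2) (p t) = s at *
    generalize √(1 - a ^ 2) = b at *
    field_simp
    grind
  · refine ((h3.mul h1).div (hds.const_mul _) (by positivity)).neg.congr_deriv ?_
    simp only [Pi.mul_apply]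
    generalize planarMoment √(1 - a ^ 2) (p t) = s at *
    generalize √(1 - a ^ 2) = b at *
    field_simp
    grind
  · refine (hds.div_const m).congr_deriv ?_
    generalize planarMoment √(1 - a ^ 2) (p t) = s at *
    generalize √(1 - a ^ 2) = b at *
    field_simp
    grind
  · refine (h2.div_const _).congr_deriv ?_
    generalize √(1 - a ^ 2) = b at *
    field_simp
  · refine (h1.div_const _).congr_deriv ?_
    generalize √(1 - a ^ 2) = b at *
    field_simp
  · refine (h3.div_const _).congr_deriv ?_
    generalize planarMoment √(1 - a ^ 2) (p t) = s at *
    generalize √(1 - a ^ 2) = b at *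
    field_simp
    grind
end

end

section

/-! ### Periods of extremals -/

/-- The elliptic description of a solution of the vertical system: `p = c ∘ φ` with an amplitude `φ`,
where `c` parametrizes a closed curve, and `m` is the length of the angular momentum. -/
structure EllipticCoordinates (a μ ω ν m : ℝ) (c : ℝ → Covector) (φ : ℝ → ℝ) : Prop where
  param : a ∈ Ioo (0 : ℝ) 1
  modulus_lt : μ < 1
  frequency_pos : 0 < ω
  characteristic_nonneg : 0 ≤ ν
  length_pos : 0 < m
  amplitude : IsAmplitude μ ω φ
  costate : IsCostate a fun t => c (φ t)
  unit : ∀ x, (c x).p₁ ^ 2 + (c x).p₂ ^ 2 = 1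
  length_eq : ∀ x, m ^ 2 * √(1 - a ^ 2) ^ 2 =
      √(1 - a ^ 2) ^ 2 * (c x).p₁ ^ 2 + (c x).p₂ ^ 2 + (c x).p₃ ^ 2
  planar_eq : ∀ x, planarMoment √(1 - a ^ 2) (c x) ^ 2 = 1 + ν * sin x ^ 2
  eq_iff : ∀ x y, c x = c y ↔ ∃ j : ℤ, x = y + j * (2 * π)

lemma rotZ_eq_iff {x y : ℝ} : rotZ x = rotZ y ↔ ∃ i : ℤ, x = y + i * (2 * π) := by
  constructor
  · intro h
    have h1 : cos x = cos y := congrFun (congrFun h 0) 0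
    have h2 : sin x = sin y := congrFun (congrFun h 1) 0
    have h3 := Real.Angle.cos_sin_inj h1 h2
    obtain ⟨i, hi⟩ := Real.Angle.angle_eq_iff_two_pi_dvd_sub.1 h3
    exact ⟨i, by linear_combination hi⟩
  · rintro ⟨i, rfl⟩
    simp [rotZ, cos_add_int_mul_two_pi, sin_add_int_mul_two_pi]

namespace EllipticCoordinates
variable {a μ ω ν m : ℝ} {c : ℝ → Covector} {φ : ℝ → ℝ}

/-- The frame along the curve, precessing about the angular momentum. -/
def curve (a μ ω ν m : ℝ) (c : ℝ → Covector) (φ : ℝ → ℝ) (t : ℝ) : Matrix (Fin 3) (Fin 3) ℝ :=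
  rotZ (m / ω * incompletePi ν μ (φ t)) * momentFrame √(1 - a ^ 2) m (c (φ t))

lemma sqrt_pos (h : EllipticCoordinates a μ ω ν m c φ) : 0 < √(1 - a ^ 2) :=
  Real.sqrt_pos.2 (one_sub_sq_pos h.param)

/-- The angle of `rotZ` grows at rate m/(1 + ν sin² φ) = m/s², cancelling the extra rotation of the
moment frame. -/
lemma hasDerivAt_curve (h : EllipticCoordinates a μ ω ν m c φ) (t : ℝ) :
    HasEntryDerivAt (curve a μ ω ν m c φ)
      (curve a μ ω ν m c φ t * velocity a (c (φ t)).p₁ (c (φ t)).p₂) t := by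
  have hω := h.frequency_pos
  have hθ : HasDerivAt (fun t => m / ω * incompletePi ν μ (φ t))
      (m / planarMoment √(1 - a ^ 2) (c (φ t)) ^ 2) t := by
    refine ((h.amplitude.hasDerivAt_incompletePi h.characteristic_nonneg h.modulus_lt t).const_mul
      (m / ω)).congr_deriv ?_
    rw [h.planar_eq]
    field_simp
  refine ((hasDerivAt_rotZ hθ).mul (hasDerivAt_momentFrame h.param h.costate (fun t => h.unit _)
    h.length_pos (fun t => h.length_eq _) t)).congr_deriv ?_
  simp only [curve, mul_sub, Matrix.smul_mul, Matrix.mul_smul, mul_assoc]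
  abel

lemma momentFrame_mul (h : EllipticCoordinates a μ ω ν m c φ) (x : ℝ) :
    momentFrame √(1 - a ^ 2) m (c x) * (momentFrame √(1 - a ^ 2) m (c x)).transpose = 1 :=
  momentFrame_mul_transpose h.sqrt_pos h.length_pos (h.unit x) (h.length_eq x)

lemma curve_mul_transpose (h : EllipticCoordinates a μ ω ν m c φ) (t : ℝ) :
    curve a μ ω ν m c φ t * (curve a μ ω ν m c φ t).transpose = 1 := by
  rw [curve, Matrix.transpose_mul, mul_assoc, ← mul_assoc (momentFrame _ _ _), h.momentFrame_mul,
    one_mul, rotZ_mul_transpose]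

/-- The explicit curve is already a solution; a left translation moves its start to the identity. -/
lemma exists_extremal (h : EllipticCoordinates a μ ω ν m c φ) :
    ∃ R : ℝ → SO3, R 0 = 1 ∧ IsExtremal a R fun t => c (φ t) := by
  let Q : ℝ → SO3 := fun t => SO3.mk (curve a μ ω ν m c φ t) (h.curve_mul_transpose t) (by
    rw [curve, Matrix.det_mul, det_rotZ,
      det_momentFrame h.sqrt_pos h.length_pos (h.unit _) (h.length_eq _), one_mul])
  refine ⟨fun t => (Q 0)⁻¹ * Q t, inv_mul_cancel _, fun t => ?_, h.costate.1, h.costate.2,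
    h.costate.3⟩
  rw [hasVelocityAt_iff]
  refine ((h.hasDerivAt_curve t).const_mul ((Q 0)⁻¹).1).congr_deriv ?_
  rw [← mul_assoc]; rfl

/-- The periods of an extremal: multiples of the period of the costate for which the total
precession is a multiple of `2 π`. -/
lemma periodic_iff (h : EllipticCoordinates a μ ω ν m c φ) {R : ℝ → SO3}
    (hR : IsExtremal a R fun t => c (φ t)) (L : ℝ) : Function.Periodic R L ↔
    ∃ j : ℤ, L = j * (4 * ellipticK μ / ω) ∧
      ∃ i : ℤ, j * (m / ω * ellipticPi (-ν) μ) = i * (π / 2) := by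
  set Y := curve a μ ω ν m c φ with hY
  have hYR (t : ℝ) : Y t = Y 0 * (R 0).1.transpose * (R t).1 :=
    eq_mul_of_same_velocity (u := fun t => ((c (φ t)).p₁, (c (φ t)).p₂)) hR.horizontal
      h.hasDerivAt_curve 0 t
  have hRY (t : ℝ) : (R t).1 = (R 0).1 * (Y 0).transpose * Y t := by
    have h1 : (Y 0).transpose * Y 0 = 1 := mul_eq_one_comm.1 (h.curve_mul_transpose 0)
    rw [hYR t]
    calc (R t).1 = (R 0).1 * 1 * (R 0).1.transpose * (R t).1 := by
          rw [mul_one, SO3.mul_transpose, one_mul]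
      _ = _ := by rw [← h1]; simp only [mul_assoc]
  have key (t s : ℝ) : R t = R s ↔ Y t = Y s := by
    constructor
    · intro h1; rw [hYR t, hYR s, h1]
    · intro h1; apply Subtype.ext; rw [hRY t, hRY s, h1]
  -- After j periods of the costate the moment frame is back, so only the angle of `rotZ` matters.
  -- It has grown by 4j(m/ω)Π, and the condition modulo 2π, divided by 4, is the stated one.
  have hstep (t : ℝ) (j : ℤ) : Y (t + j * (4 * ellipticK μ / ω)) = Y t ↔
      ∃ i : ℤ, j * (m / ω * ellipticPi (-ν) μ) = i * (π / 2) := by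
    have h1 := h.amplitude.add_period h.modulus_lt h.frequency_pos t j
    have h2 : c (φ (t + j * (4 * ellipticK μ / ω))) = c (φ t) := (h.eq_iff _ _).2 ⟨j, h1⟩
    have h3 : Y (t + j * (4 * ellipticK μ / ω)) = Y t ↔
        rotZ (m / ω * incompletePi ν μ (φ (t + j * (4 * ellipticK μ / ω)))) =
        rotZ (m / ω * incompletePi ν μ (φ t)) := by
      simp only [hY, curve, h2]
      constructor
      · intro h4
        have := congrArg (· * (momentFrame √(1 - a ^ 2) m (c (φ t))).transpose) h4
        simpa only [mul_assoc, h.momentFrame_mul, mul_one] using this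
      · intro h4; rw [h4]
    rw [h3, rotZ_eq_iff, h1, incompletePi_add_mul_two_pi h.characteristic_nonneg h.modulus_lt]
    refine exists_congr fun i => ⟨fun h4 => ?_, fun h4 => ?_⟩
    · linear_combination h4 / 4
    · linear_combination 4 * h4
  constructor
  · intro hL
    -- A period of R is a period of p, hence a multiple of 4K/ω.
    have hp := hR.periodic_costate h.param (h.unit _) hL 0
    rw [zero_add] at hp
    obtain ⟨j, hj⟩ := (h.eq_iff _ _).1 hp
    have hLj := h.amplitude.eq_period h.modulus_lt h.frequency_pos hj
    refine ⟨j, hLj, (hstep 0 j).1 ?_⟩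
    rw [← hLj]; exact (key _ _).1 (hL 0)
  · rintro ⟨j, rfl, hi⟩ t
    exact (key _ _).2 ((hstep t j).2 hi)

end EllipticCoordinates

/-! ### From the precession condition to reduced fractions -/

lemma isMinimalPeriod_of_periodic_iff {R : ℝ → SO3} {T G : ℝ} (hT : 0 < T)
    (h : ∀ L, Function.Periodic R L ↔ ∃ j : ℤ, L = j * T ∧ ∃ i : ℤ, j * G = i * (π / 2))
    {n m : ℕ} (hm : 0 < m) (hnm : n.Coprime m) (hG : G = π / 2 * ((n : ℝ) / m)) :
    IsMinimalPeriod R (m * T) := by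
  have hm' : (0 : ℝ) < m := by exact_mod_cast hm
  refine ⟨⟨by positivity, (h _).2 ⟨m, by simp, n, ?_⟩⟩, ?_⟩
  · rw [hG]; push_cast; field_simp
  · rintro L ⟨hL, hper⟩
    obtain ⟨j, rfl, i, hi⟩ := (h L).1 hper
    have h1 : (j : ℝ) * n = i * m := by
      rw [hG] at hi; field_simp at hi; linear_combination hi
    have h2 : j * n = i * m := by exact_mod_cast h1
    -- From jn = im and coprimality, every admissible j is a multiple of m.
    have h3 : (m : ℤ) ∣ j := by
      refine IsCoprime.dvd_of_dvd_mul_right (Nat.isCoprime_iff_coprime.2 hnm.symm) ?_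
      exact ⟨i, by rw [h2, mul_comm]⟩
    have h4 : 0 < j := by exact_mod_cast (pos_iff_pos_of_mul_pos hL).2 hT
    have h5 : (m : ℝ) ≤ j := by exact_mod_cast Int.le_of_dvd h4 h3
    gcongr

lemma exists_fraction_of_periodic_iff {R : ℝ → SO3} {T G : ℝ} (hT : 0 < T) (hG : 0 < G)
    (h : ∀ L, Function.Periodic R L ↔ ∃ j : ℤ, L = j * T ∧ ∃ i : ℤ, j * G = i * (π / 2))
    (hR : IsPeriodic R) : ∃ n m : ℕ, 0 < m ∧ n.Coprime m ∧ G = π / 2 * ((n : ℝ) / m) := by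
  obtain ⟨L, hL, hper⟩ := hR
  obtain ⟨j, rfl, i, hi⟩ := (h L).1 hper
  have hj : (0 : ℝ) < j := (pos_iff_pos_of_mul_pos hL).2 hT
  have hi0 : (0 : ℝ) < i := (pos_iff_pos_of_mul_pos (hi ▸ mul_pos hj hG)).2 (by positivity)
  have hq : G = π / 2 * (((i / j : ℚ)) : ℝ) := by
    push_cast; field_simp; linear_combination 2 * hi
  have hq0 : (0 : ℚ) < i / j := by
    have h1 : (0 : ℚ) < i := by exact_mod_cast hi0
    have h2 : (0 : ℚ) < j := by exact_mod_cast hj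
    positivity
  generalize (i / j : ℚ) = q at hq hq0
  refine ⟨q.num.natAbs, q.den, q.den_pos, q.reduced, ?_⟩
  rw [hq, Rat.cast_def]
  congr 2
  have : (q.num.natAbs : ℤ) = q.num := Int.natAbs_of_nonneg (Rat.num_pos.2 hq0).le
  rw [← Int.cast_natCast, this]

lemma cos_sin_eq_iff {x y : ℝ} :
    (cos x = cos y ∧ sin x = sin y) ↔ ∃ j : ℤ, x = y + j * (2 * π) := by
  rw [← rotZ_eq_iff]
  constructor
  · rintro ⟨h1, h2⟩; simp [rotZ, h1, h2]
  · intro h; exact ⟨congrFun (congrFun h 0) 0, congrFun (congrFun h 1) 0⟩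

/-- On the unit circle b²p₁² + p₂² = 1 - a²p₁², so s² depends on p₁ only. -/
lemma planarMoment_sq_eq {b a : ℝ} (hb : 0 < b) (hb2 : b ^ 2 = 1 - a ^ 2) {p : Covector}
    {ν y : ℝ} (hp : p.p₁ ^ 2 + p.p₂ ^ 2 = 1) (h : 1 - a ^ 2 * p.p₁ ^ 2 = b ^ 2 * (1 + ν * y)) :
    planarMoment b p ^ 2 = 1 + ν * y := by
  have h1 := planarMoment_sq hb p
  have hb2' : b ^ 2 ≠ 0 := by positivity
  apply mul_left_cancel₀ hb2'
  rw [h1, ← h]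
  linear_combination p.p₁ ^ 2 * hb2 + hp

lemma ellipticCoordinates_oscillating {a k σ : ℝ} {φ : ℝ → ℝ} (ha : a ∈ Ioo (0 : ℝ) 1)
    (hk : k ∈ Ioo (0 : ℝ) 1) (hσ : σ = 1 ∨ σ = -1) (hφ : IsAmplitude (k ^ 2) a φ) :
    EllipticCoordinates a (k ^ 2) a (a ^ 2 / (1 - a ^ 2) * k ^ 2)
      √(1 + a ^ 2 / (1 - a ^ 2) * k ^ 2) (oscillating a k σ) φ := by
  have hb := one_sub_sq_pos ha
  have hb2 := sq_sqrt hb.le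
  have h1 := (sq_mem_Ico ⟨hk.1.le, hk.2⟩).2
  have ha0 := ha.1
  have hk0 := hk.1
  have hσ2 : σ ^ 2 = 1 := by rcases hσ with rfl | rfl <;> norm_num
  have hu (x : ℝ) := (oscillating_mem ha.1 hk hσ x).1.1
  have hp1 (x : ℝ) : (oscillating a k σ x).p₁ ^ 2 = 1 - k ^ 2 * sin x ^ 2 := by
    simp only [oscillating]
    rw [mul_pow, sq_sqrt (mul_sin_sq_lt_one h1 x).le, hσ2, one_mul]
  refine ⟨ha, h1, ha.1, by positivity, Real.sqrt_pos.2 (by positivity), hφ,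
    isCostate_oscillating hk hσ hφ, hu, fun x => ?_, fun x => ?_, fun x y => ?_⟩
  · have h2 : (oscillating a k σ x).p₂ ^ 2 = 1 - (1 - k ^ 2 * sin x ^ 2) := by
      rw [← hp1]; linear_combination hu x
    rw [sq_sqrt (by positivity), hb2, hp1, h2]
    simp only [oscillating]
    field_simp
    linear_combination -(a ^ 2 * k ^ 2) * sin_sq_add_cos_sq x
  · refine planarMoment_sq_eq (sqrt_pos.2 hb) hb2 (hu x) ?_
    rw [hp1, hb2]; field_simp; ring
  -- For fixed σ the coordinates p₂ and p₃ recover sin x and cos x, so the costate curve closes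
  -- after exactly 2π and not earlier.
  · rw [← cos_sin_eq_iff]
    constructor
    · intro h
      have h2 := congrArg Covector.p₂ h
      have h3 := congrArg Covector.p₃ h
      have hσ0 : σ ≠ 0 := by rintro rfl; norm_num at hσ2
      simp only [oscillating, neg_inj] at h2 h3
      exact ⟨mul_left_cancel₀ (by positivity) h3,
        mul_left_cancel₀ hk0.ne' (mul_left_cancel₀ hσ0 h2)⟩
    · rintro ⟨h2, h3⟩; simp only [oscillating, h2, h3]

lemma ellipticCoordinates_rotating {a k σ : ℝ} {φ : ℝ → ℝ} (ha : a ∈ Ioo (0 : ℝ) 1)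
    (hk : k ∈ Ioo (0 : ℝ) 1) (hσ : σ = 1 ∨ σ = -1) (hφ : IsAmplitude (k ^ 2) (a / k) φ) :
    EllipticCoordinates a (k ^ 2) (a / k) (a ^ 2 / (1 - a ^ 2))
      √(1 + a ^ 2 / (1 - a ^ 2) / k ^ 2) (rotating a k σ) φ := by
  have hb := one_sub_sq_pos ha
  have hb2 := sq_sqrt hb.le
  have h1 := (sq_mem_Ico ⟨hk.1.le, hk.2⟩).2
  have ha0 := ha.1
  have hk0 := hk.1
  have hσ2 : σ ^ 2 = 1 := by rcases hσ with rfl | rfl <;> norm_num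
  have hu (x : ℝ) := (rotating_mem ha.1 hk hσ x).1.1
  have hp1 (x : ℝ) : (rotating a k σ x).p₁ ^ 2 = 1 - sin x ^ 2 := by
    simp only [rotating]; rw [cos_sq']
  have hp3 (x : ℝ) : (rotating a k σ x).p₃ ^ 2 = a ^ 2 / k ^ 2 * (1 - k ^ 2 * sin x ^ 2) := by
    simp only [rotating]
    rw [mul_pow, mul_pow, sq_sqrt (mul_sin_sq_lt_one h1 x).le, hσ2, one_mul, div_pow]
  refine ⟨ha, h1, by positivity, by positivity, Real.sqrt_pos.2 (by positivity), hφ,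
    isCostate_rotating hk hσ hφ, hu, fun x => ?_, fun x => ?_, fun x y => ?_⟩
  · have h2 : (rotating a k σ x).p₂ ^ 2 = 1 - (1 - sin x ^ 2) := by
      rw [← hp1]; linear_combination hu x
    rw [sq_sqrt (by positivity), hb2, hp1, h2, hp3]
    field_simp
    ring
  · refine planarMoment_sq_eq (sqrt_pos.2 hb) hb2 (hu x) ?_
    rw [hp1, hb2]; field_simp; ring
  · rw [← cos_sin_eq_iff]
    constructor
    · intro h
      have h2 := congrArg Covector.p₁ h
      have h3 := congrArg Covector.p₂ h
      have hσ0 : σ ≠ 0 := by rintro rfl; norm_num at hσ2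
      simp only [rotating, neg_inj] at h2 h3
      exact ⟨h2, mul_left_cancel₀ hσ0 h3⟩
    · rintro ⟨h2, h3⟩; simp only [rotating, h2, h3]

lemma periodic_iff_of_mem_C₁ {a : ℝ} (ha : a ∈ Ioo (0 : ℝ) 1) {R : ℝ → SO3} {p : ℝ → Covector}
    (hR : IsExtremal a R p) (hp : p 0 ∈ C₁ a) (L : ℝ) : Function.Periodic R L ↔
    ∃ j : ℤ, L = j * (4 * ellipticK (modulus₁ a (p 0) ^ 2) / a) ∧
      ∃ i : ℤ, j * G₁ a (modulus₁ a (p 0)) = i * (π / 2) := by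
  obtain ⟨σ, φ, hσ, hφ, h⟩ := hR.isCostate.eq_oscillating ha.1 hp
  have hk := (exists_eq_oscillating ha.1 hp).1
  have he := ellipticCoordinates_oscillating ha hk hσ hφ
  rw [funext h] at hR
  rw [he.periodic_iff hR L, G₁_eq ha]
  refine exists_congr fun j => and_congr_right fun _ => exists_congr fun i => ?_
  rw [← mul_assoc (1 / a), one_div_mul_eq_div]

lemma periodic_iff_of_mem_C₂ {a : ℝ} (ha : a ∈ Ioo (0 : ℝ) 1) {R : ℝ → SO3} {p : ℝ → Covector}
    (hR : IsExtremal a R p) (hp : p 0 ∈ C₂ a) (L : ℝ) : Function.Periodic R L ↔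
    ∃ j : ℤ, L = j * (4 * modulus₂ a (p 0) * ellipticK (modulus₂ a (p 0) ^ 2) / a) ∧
      ∃ i : ℤ, j * G₂ a (modulus₂ a (p 0)) = i * (π / 2) := by
  obtain ⟨σ, φ, hσ, hφ, h⟩ := hR.isCostate.eq_rotating ha.1 hp
  have hk := (exists_eq_rotating ha.1 hp).1
  have he := ellipticCoordinates_rotating ha hk hσ hφ
  rw [funext h] at hR
  rw [he.periodic_iff hR L, G₂_eq]
  have hb := one_sub_sq_pos ha
  have ha0 := ha.1
  generalize modulus₂ a (p 0) = k at hk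
  have hk0 := hk.1
  have e1 : 4 * ellipticK (k ^ 2) / (a / k) = 4 * k * ellipticK (k ^ 2) / a := by field_simp
  -- The ratio m/ω is precisely the prefactor of `G₂`.
  have e2 : √(1 + a ^ 2 / (1 - a ^ 2) / k ^ 2) / (a / k) =
      √((a ^ 2 + (1 - a ^ 2) * k ^ 2) / (a ^ 2 * (1 - a ^ 2))) := by
    rw [div_eq_mul_inv, ← sqrt_sq (by positivity : 0 ≤ (a / k)⁻¹), ← sqrt_mul (by positivity)]
    congr 1; field_simp; ring
  rw [e1, e2]

lemma exists_extremal_C₁ {a k : ℝ} (ha : a ∈ Ioo (0 : ℝ) 1) (hk : k ∈ Ioo (0 : ℝ) 1) :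
    ∃ R p, R 0 = 1 ∧ IsExtremal a R p ∧ p 0 ∈ C₁ a ∧ modulus₁ a (p 0) = k := by
  obtain ⟨φ, hφ, -⟩ := exists_isAmplitude (sq_mem_Ico ⟨hk.1.le, hk.2⟩).2 a 0
  obtain ⟨R, h0, hR⟩ := (ellipticCoordinates_oscillating ha hk (Or.inl rfl) hφ).exists_extremal
  exact ⟨R, _, h0, hR, oscillating_mem ha.1 hk (Or.inl rfl) _⟩

lemma exists_extremal_C₂ {a k : ℝ} (ha : a ∈ Ioo (0 : ℝ) 1) (hk : k ∈ Ioo (0 : ℝ) 1) :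
    ∃ R p, R 0 = 1 ∧ IsExtremal a R p ∧ p 0 ∈ C₂ a ∧ modulus₂ a (p 0) = k := by
  obtain ⟨φ, hφ, -⟩ := exists_isAmplitude (sq_mem_Ico ⟨hk.1.le, hk.2⟩).2 (a / k) 0
  obtain ⟨R, h0, hR⟩ := (ellipticCoordinates_rotating ha hk (Or.inl rfl) hφ).exists_extremal
  exact ⟨R, _, h0, hR, rotating_mem ha.1 hk (Or.inl rfl) _⟩

/-! ### Congruence of extremals with the same modulus -/

lemma exists_diag {d₀ d₁ d₂ : ℝ} (h₀ : d₀ ^ 2 = 1) (h₁ : d₁ ^ 2 = 1) (h₂ : d₂ ^ 2 = 1)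
    (h : d₀ * d₁ * d₂ = 1) :
    ∃ S : SO3, S.1.IsDiag ∧ S.1 0 0 = d₀ ∧ S.1 1 1 = d₁ ∧ S.1 2 2 = d₂ := by
  refine ⟨SO3.mk (Matrix.diagonal ![d₀, d₁, d₂]) ?_ ?_, Matrix.isDiag_diagonal _, ?_, ?_, ?_⟩
  · rw [Matrix.diagonal_transpose, Matrix.diagonal_mul_diagonal, ← Matrix.diagonal_one]
    congr 1; ext i; fin_cases i <;> simp [← sq, h₀, h₁, h₂]
  · simp [Matrix.det_diagonal, Fin.prod_univ_three, h]
  all_goals simp [SO3.mk]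

lemma sign_mul {σ τ : ℝ} (hσ : σ = 1 ∨ σ = -1) (hτ : τ = 1 ∨ τ = -1) :
    ∃ ε : ℝ, ε ^ 2 = 1 ∧ τ = ε * σ := by
  refine ⟨τ * σ, ?_, ?_⟩ <;> rcases hσ with rfl | rfl <;> rcases hτ with rfl | rfl <;> norm_num

lemma congruent_of_modulus₁_eq {a : ℝ} (ha : a ∈ Ioo (0 : ℝ) 1) {R Q : ℝ → SO3}
    {p q : ℝ → Covector} (hR : IsExtremal a R p) (hQ : IsExtremal a Q q) (hp : p 0 ∈ C₁ a)
    (hq : q 0 ∈ C₁ a) (h : modulus₁ a (p 0) = modulus₁ a (q 0)) : Congruent R Q := by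
  obtain ⟨σ, φ, hσ, hφ, hpφ⟩ := hR.isCostate.eq_oscillating ha.1 hp
  obtain ⟨τ, ψ, hτ, hψ, hqψ⟩ := hQ.isCostate.eq_oscillating ha.1 hq
  have hk := (exists_eq_oscillating ha.1 hp).1
  rw [← h] at hψ hqψ
  obtain ⟨t₀, ht⟩ := hφ.exists_shift hψ (sq_mem_Ico ⟨hk.1.le, hk.2⟩).2 ha.1
  obtain ⟨ε, hε, rfl⟩ := sign_mul hσ hτ
  -- On C₁ the sign σ multiplies both p₁ and p₂, which is the effect of S = diag(ε, ε, 1).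
  obtain ⟨S, hS, h0, h1, h2⟩ := exists_diag hε hε (one_pow 2) (by linear_combination hε)
  refine congruent_of_controls hR hQ hS (t₀ := t₀) (fun t => ?_) (fun t => ?_)
  · rw [hqψ t, hpφ (t + t₀), h0, h2, ht]; simp only [oscillating]; ring
  · rw [hqψ t, hpφ (t + t₀), h1, h2, ht]; simp only [oscillating]; ring

lemma congruent_of_modulus₂_eq {a : ℝ} (ha : a ∈ Ioo (0 : ℝ) 1) {R Q : ℝ → SO3}
    {p q : ℝ → Covector} (hR : IsExtremal a R p) (hQ : IsExtremal a Q q) (hp : p 0 ∈ C₂ a)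
    (hq : q 0 ∈ C₂ a) (h : modulus₂ a (p 0) = modulus₂ a (q 0)) : Congruent R Q := by
  obtain ⟨σ, φ, hσ, hφ, hpφ⟩ := hR.isCostate.eq_rotating ha.1 hp
  obtain ⟨τ, ψ, hτ, hψ, hqψ⟩ := hQ.isCostate.eq_rotating ha.1 hq
  have hk := (exists_eq_rotating ha.1 hp).1
  rw [← h] at hψ hqψ
  obtain ⟨t₀, ht⟩ := hφ.exists_shift hψ (sq_mem_Ico ⟨hk.1.le, hk.2⟩).2 (div_pos ha.1 hk.1)
  obtain ⟨ε, hε, rfl⟩ := sign_mul hσ hτ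
  -- On C₂ the sign enters p₂ but not p₁, so S = diag(ε, 1, ε).
  obtain ⟨S, hS, h0, h1, h2⟩ := exists_diag hε (one_pow 2) hε (by linear_combination hε)
  refine congruent_of_controls hR hQ hS (t₀ := t₀) (fun t => ?_) (fun t => ?_)
  · rw [hqψ t, hpφ (t + t₀), h0, h2, ht, ← sq, hε, one_mul]; rfl
  · rw [hqψ t, hpφ (t + t₀), h1, h2, ht]; simp only [rotating]; ring

end

/-! ### Short arcs of extremals are length minimizers -/

lemma _root_.LipschitzWith.comp_absolutelyContinuousOnInterval {f g : ℝ → ℝ} {K : NNReal} {s t : ℝ}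
    (hf : LipschitzWith K f) (hg : AbsolutelyContinuousOnInterval g s t) :
    AbsolutelyContinuousOnInterval (f ∘ g) s t := by
  have h : Filter.Tendsto _ _ _ := hg
  have h2 := h.const_mul (K : ℝ)
  rw [mul_zero] at h2
  refine squeeze_zero (fun E => Finset.sum_nonneg fun i _ => dist_nonneg) (fun E => ?_) h2
  rw [Finset.mul_sum]
  exact Finset.sum_le_sum fun i _ => hf.dist_le_mul _ _

lemma _root_.AbsolutelyContinuousOnInterval.fun_sum {ι : Type*} (u : Finset ι) {f : ι → ℝ → ℝ}
    {s t : ℝ} (h : ∀ i ∈ u, AbsolutelyContinuousOnInterval (f i) s t) :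
    AbsolutelyContinuousOnInterval (fun x => ∑ i ∈ u, f i x) s t := by
  classical
  induction u using Finset.induction_on with
  | empty =>
    simp only [Finset.sum_empty]
    exact (LipschitzWith.const (0 : ℝ)).lipschitzOnWith.absolutelyContinuousOnInterval
  | insert i u hi ih =>
    simp only [Finset.sum_insert hi]
    exact (h i (Finset.mem_insert_self i u)).fun_add
      (ih fun j hj => h j (Finset.mem_insert_of_mem hj))

lemma intervalIntegrable_sqrt_sq_add_sq {f g : ℝ → ℝ} {s t : ℝ}
    (hf : IntervalIntegrable f volume s t) (hg : IntervalIntegrable g volume s t) :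
    IntervalIntegrable (fun x => √(f x ^ 2 + g x ^ 2)) volume s t := by
  rw [intervalIntegrable_iff] at *
  refine (hf.abs.add hg.abs).mono' ?_ (Filter.Eventually.of_forall fun x => ?_)
  · exact continuous_sqrt.comp_aestronglyMeasurable
      ((hf.aestronglyMeasurable.pow 2).add (hg.aestronglyMeasurable.pow 2))
  · rw [norm_eq_abs, abs_of_nonneg (sqrt_nonneg _), Pi.add_apply]
    refine sqrt_le_iff.2 ⟨by positivity, ?_⟩
    nlinarith [sq_abs (f x), sq_abs (g x), mul_nonneg (abs_nonneg (f x)) (abs_nonneg (g x))]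

lemma SO3.abs_apply_le_one (R : SO3) (i j : Fin 3) : |R.1 i j| ≤ 1 := by
  have h := congrFun (congrFun (SO3.mul_transpose R) i) i
  simp only [Matrix.mul_apply, Matrix.transpose_apply, Matrix.one_apply_eq] at h
  have h2 : R.1 i j * R.1 i j ≤ ∑ k, R.1 i k * R.1 i k :=
    Finset.single_le_sum (f := fun k => R.1 i k * R.1 i k) (fun k _ => mul_self_nonneg _)
      (Finset.mem_univ j)
  rw [← sq_le_one_iff_abs_le_one]
  nlinarith

lemma abs_mul_apply_le {A B : Matrix (Fin 3) (Fin 3) ℝ} {x y : ℝ} (hA : ∀ i j, |A i j| ≤ x)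
    (hB : ∀ i j, |B i j| ≤ y) (i j : Fin 3) : |(A * B) i j| ≤ 3 * x * y := by
  rw [Matrix.mul_apply]
  have hx : 0 ≤ x := (abs_nonneg _).trans (hA 0 0)
  calc |∑ k, A i k * B k j| ≤ ∑ k, |A i k * B k j| := Finset.abs_sum_le_sum_abs _ _
    _ ≤ ∑ _k : Fin 3, x * y := by
        refine Finset.sum_le_sum fun k _ => ?_
        rw [abs_mul]
        exact mul_le_mul (hA i k) (hB k j) (abs_nonneg _) hx
    _ = 3 * x * y := by simp; ring

lemma abs_velocity_apply_le {a : ℝ} (u₁ u₂ : ℝ) (i j : Fin 3) :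
    |velocity a u₁ u₂ i j| ≤ |u₁| + |u₂| := by
  have hb : √(1 - a ^ 2) ≤ 1 := sqrt_le_iff.2 ⟨zero_le_one, by nlinarith [sq_nonneg a]⟩
  have hb0 := sqrt_nonneg (1 - a ^ 2)
  have h1 := abs_nonneg u₁
  have h2 := abs_nonneg u₂
  have h3 : √(1 - a ^ 2) * |u₂| ≤ |u₂| := mul_le_of_le_one_left h2 hb
  rw [velocity_eq]
  fin_cases i <;> fin_cases j <;> simp [abs_mul, abs_of_nonneg hb0] <;> linarith

lemma abs_conj_velocity_apply_le {a : ℝ} (Q P : SO3) (u₁ u₂ : ℝ) (i j : Fin 3) :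
    |(Q.1 * velocity a u₁ u₂ * P.1.transpose) i j| ≤ 9 * (|u₁| + |u₂|) := by
  refine (abs_mul_apply_le (abs_mul_apply_le (SO3.abs_apply_le_one Q)
    (abs_velocity_apply_le u₁ u₂)) (fun i j => SO3.abs_apply_le_one P j i) i j).trans (le_of_eq ?_)
  ring

/-! ### The momentum pairing and the defect between two curves -/

lemma velocity_sub (a u₁ u₂ v₁ v₂ : ℝ) :
    velocity a (u₁ - v₁) (u₂ - v₂) = velocity a u₁ u₂ - velocity a v₁ v₂ := by
  simp only [velocity, sub_smul]; abel

/-- The pairing of matrices which is half of the Frobenius inner product. -/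
def pairing (A B : Matrix (Fin 3) (Fin 3) ℝ) : ℝ := 1 / 2 * ∑ i, ∑ j, A i j * B i j

lemma pairing_eq_trace (A B : Matrix (Fin 3) (Fin 3) ℝ) :
    pairing A B = 1 / 2 * (A.transpose * B).trace := by
  simp only [pairing, Matrix.trace, Matrix.diag, Matrix.mul_apply, Matrix.transpose_apply]
  rw [Finset.sum_comm]

lemma pairing_conj (A V P : Matrix (Fin 3) (Fin 3) ℝ) :
    pairing A (P * V * P.transpose) = pairing (P.transpose * A * P) V := by
  rw [pairing_eq_trace, pairing_eq_trace, Matrix.transpose_mul, Matrix.transpose_mul,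
    Matrix.transpose_transpose]
  congr 1
  rw [← mul_assoc, ← mul_assoc, Matrix.trace_mul_comm]
  simp only [mul_assoc]

lemma pairing_add (A B C : Matrix (Fin 3) (Fin 3) ℝ) :
    pairing A (B + C) = pairing A B + pairing A C := by
  simp only [pairing, Matrix.add_apply, mul_add, Finset.sum_add_distrib]

lemma abs_pairing_le {A B : Matrix (Fin 3) (Fin 3) ℝ} {x y : ℝ} (hA : ∀ i j, |A i j| ≤ x)
    (hB : ∀ i j, |B i j| ≤ y) : |pairing A B| ≤ 9 / 2 * (x * y) := by
  have hx : 0 ≤ x := (abs_nonneg _).trans (hA 0 0)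
  rw [pairing, abs_mul, abs_of_pos (by norm_num : (0 : ℝ) < 1 / 2)]
  have : |∑ i, ∑ j, A i j * B i j| ≤ ∑ _i : Fin 3, ∑ _j : Fin 3, x * y := by
    refine (Finset.abs_sum_le_sum_abs _ _).trans (Finset.sum_le_sum fun i _ =>
      (Finset.abs_sum_le_sum_abs _ _).trans (Finset.sum_le_sum fun j _ => ?_))
    rw [abs_mul]
    exact mul_le_mul (hA i j) (hB i j) (abs_nonneg _) hx
  simp at this
  linarith

lemma hasDerivAt_pairing (A : Matrix (Fin 3) (Fin 3) ℝ) {Y : ℝ → Matrix (Fin 3) (Fin 3) ℝ}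
    {Y' : Matrix (Fin 3) (Fin 3) ℝ} {t : ℝ} (h : HasEntryDerivAt Y Y' t) :
    HasDerivAt (fun τ => pairing A (Y τ)) (pairing A Y') t :=
  (HasDerivAt.fun_sum fun i _ => HasDerivAt.fun_sum fun j _ => (h i j).const_mul (A i j)).const_mul _

/-- For two horizontal curves `P`, `Q` with the same end points, the function
`r ↦ pairing A (Q P⁻¹)` has integral derivative zero, and this derivative is to first order the
pairing of the difference of the controls with the body representation of `A`. -/
lemma exists_defect {a T : ℝ} (hT : 0 < T) {P Q : ℝ → SO3} {α v : ℝ → ℝ × ℝ}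
    (hP : ∀ i j, AbsolutelyContinuousOnInterval (fun x => (P x).1 i j) 0 T)
    (hQ : ∀ i j, AbsolutelyContinuousOnInterval (fun x => (Q x).1 i j) 0 T)
    (hPα : ∀ᵐ x, x ∈ uIcc 0 T → HasVelocityAt a P (α x).1 (α x).2 x)
    (hQv : ∀ᵐ x, x ∈ uIcc 0 T → HasVelocityAt a Q (v x).1 (v x).2 x)
    {w : ℝ → ℝ × ℝ} (hw : w = fun x => ((v x).1 - (α x).1, (v x).2 - (α x).2))
    (hi : IntervalIntegrable (fun x => |(w x).1| + |(w x).2|) volume 0 T)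
    (h0 : Q 0 = P 0) (h1 : Q T = P T) {A : Matrix (Fin 3) (Fin 3) ℝ} {M : ℝ}
    (hA : ∀ i j, |A i j| ≤ M) :
    ∃ f' : ℝ → ℝ, IntervalIntegrable f' volume 0 T ∧ ∫ x in (0 : ℝ)..T, f' x = 0 ∧
      ∀ᵐ x, x ∈ uIcc 0 T →
        |f' x - pairing ((P x).1.transpose * A * (P x).1) (velocity a (w x).1 (w x).2)| ≤
          1100 * M * (∫ x in (0 : ℝ)..T, |(w x).1| + |(w x).2|) * (|(w x).1| + |(w x).2|) := by
  set W := ∫ x in (0 : ℝ)..T, |(w x).1| + |(w x).2| with hW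
  -- The defect is the identity at both ends, and its derivative contains only the difference w of
  -- the controls, because velocities are antisymmetric.
  let D : ℝ → Matrix (Fin 3) (Fin 3) ℝ := fun x => (Q x).1 * (P x).1.transpose
  have hD (i j) : AbsolutelyContinuousOnInterval (fun x => D x i j) 0 T := by
    simp only [D, Matrix.mul_apply, Matrix.transpose_apply]
    exact AbsolutelyContinuousOnInterval.fun_sum _ fun k _ => (hQ i k).fun_mul (hP j k)
  have hD' : ∀ᵐ x, x ∈ uIcc 0 T → HasEntryDerivAt D
      ((Q x).1 * velocity a (w x).1 (w x).2 * (P x).1.transpose) x := by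
    filter_upwards [hPα, hQv] with x hx hx' hxT
    refine ((hasVelocityAt_iff.1 (hx' hxT)).mul (hasVelocityAt_iff.1 (hx hxT)).transpose).congr_deriv
      ?_
    rw [Matrix.transpose_mul, velocity_transpose, hw]
    simp only [velocity_sub]
    noncomm_ring
  have hend (x) (h : Q x = P x) : D x = 1 := by simp only [D, h, SO3.mul_transpose]
  have hdist : ∀ x ∈ uIcc 0 T, ∀ i j, |(D x - 1) i j| ≤ 9 * W := by
    intro x hx i j
    rw [uIcc_of_le hT.le] at hx
    have hsub : uIcc 0 x ⊆ uIcc 0 T := by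
      rw [uIcc_of_le hx.1, uIcc_of_le hT.le]; exact Icc_subset_Icc_right hx.2
    have hac := (hD i j).mono hsub
    have hFTC := hac.integral_deriv_eq_sub
    rw [hend 0 h0] at hFTC
    rw [Matrix.sub_apply, ← hFTC]
    have hi' : IntervalIntegrable (fun x => 9 * (|(w x).1| + |(w x).2|)) volume 0 x :=
      (hi.mono_set hsub).const_mul 9
    calc |∫ y in (0 : ℝ)..x, deriv (fun y => D y i j) y|
        ≤ ∫ y in (0 : ℝ)..x, 9 * (|(w y).1| + |(w y).2|) := by
          rw [← norm_eq_abs]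
          refine intervalIntegral.norm_integral_le_of_norm_le hx.1 ?_ hi'
          filter_upwards [hD'] with y hy hyx
          have hyT : y ∈ uIcc 0 T := hsub (by rw [uIcc_of_le hx.1]; exact Ioc_subset_Icc_self hyx)
          rw [(hy hyT i j).deriv]
          exact abs_conj_velocity_apply_le _ _ _ _ i j
      _ ≤ ∫ y in (0 : ℝ)..T, 9 * (|(w y).1| + |(w y).2|) := by
          refine intervalIntegral.integral_mono_interval le_rfl hx.1 hx.2 ?_ (hi.const_mul 9)
          exact Filter.Eventually.of_forall fun y => by simp only [Pi.zero_apply]; positivity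
      _ = 9 * W := intervalIntegral.integral_const_mul _ _
  have hf : AbsolutelyContinuousOnInterval (fun x => pairing A (D x)) 0 T :=
    (AbsolutelyContinuousOnInterval.fun_sum _ fun i _ => AbsolutelyContinuousOnInterval.fun_sum _
      fun j _ => (hD i j).const_mul (A i j)).const_mul _
  refine ⟨deriv fun x => pairing A (D x), hf.intervalIntegrable_deriv, ?_, ?_⟩
  · rw [hf.integral_deriv_eq_sub, hend 0 h0, hend T h1, sub_self]
  · filter_upwards [hD'] with x hx hxT
    rw [(hasDerivAt_pairing A (hx hxT)).deriv]
    set N := (P x).1 * velocity a (w x).1 (w x).2 * (P x).1.transpose with hN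
    -- Since Q = DP, replacing Q by P costs a term with the factor D - 1, which is at most 9W and
    -- hence of second order in w.
    have hQP : (Q x).1 * velocity a (w x).1 (w x).2 * (P x).1.transpose = N + (D x - 1) * N := by
      rw [sub_mul, one_mul, add_sub_cancel, hN]
      simp only [D]
      calc _ = (Q x).1 * 1 * velocity a (w x).1 (w x).2 * (P x).1.transpose := by rw [mul_one]
        _ = _ := by rw [← SO3.transpose_mul (P x)]; simp only [mul_assoc]
    rw [hQP, pairing_add, hN, pairing_conj, add_sub_cancel_left, ← hN]
    -- The constants multiply to (9/2)·3·9·9 = 1093.5, rounded up to 1100.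
    have h2 := abs_pairing_le hA (abs_mul_apply_le (hdist x hxT)
      (abs_conj_velocity_apply_le (a := a) (P x) (P x) (w x).1 (w x).2))
    refine h2.trans ?_
    have hM : 0 ≤ M := (abs_nonneg _).trans (hA 0 0)
    have hW0 : 0 ≤ W := intervalIntegral.integral_nonneg hT.le fun y _ => by positivity
    have h3 : 0 ≤ M * (W * (|(w x).1| + |(w x).2|)) := by positivity
    linarith

/-- The angular momentum of a covector, as an antisymmetric matrix. -/
def momentMatrix (b : ℝ) (p : Covector) : Matrix (Fin 3) (Fin 3) ℝ :=
  !![0, -(p.p₃ / b), p.p₁; p.p₃ / b, 0, -(p.p₂ / b); -p.p₁, p.p₂ / b, 0]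

lemma pairing_momentMatrix {a : ℝ} (ha : a ∈ Ioo (0 : ℝ) 1) (p : Covector) (w₁ w₂ : ℝ) :
    pairing (momentMatrix √(1 - a ^ 2) p) (velocity a w₁ w₂) = p.p₁ * w₁ + p.p₂ * w₂ := by
  have hb := (sqrt_pos.2 (one_sub_sq_pos ha)).ne'
  simp [pairing, momentMatrix, velocity_eq, Fin.sum_univ_three]
  field_simp; ring

/-- The Hamiltonian system is the Lax equation M' = MV - VM, so RMRᵀ is constant. -/
lemma IsExtremal.momentMatrix_eq {a : ℝ} (ha : a ∈ Ioo (0 : ℝ) 1) {R : ℝ → SO3}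
    {p : ℝ → Covector} (h : IsExtremal a R p) (t : ℝ) :
    (R t).1.transpose * ((R 0).1 * momentMatrix √(1 - a ^ 2) (p 0) * (R 0).1.transpose) * (R t).1 =
      momentMatrix √(1 - a ^ 2) (p t) := by
  have hb := sqrt_pos.2 (one_sub_sq_pos ha)
  have hb2 := sq_sqrt (one_sub_sq_pos ha).le
  have hM (t : ℝ) : HasEntryDerivAt (fun t => momentMatrix √(1 - a ^ 2) (p t))
      (momentMatrix √(1 - a ^ 2) (p t) * velocity a (p t).p₁ (p t).p₂ -
        velocity a (p t).p₁ (p t).p₂ * momentMatrix √(1 - a ^ 2) (p t)) t := by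
    have h1 := h.deriv_p₁ t
    have h2 := (h.deriv_p₂ t).div_const √(1 - a ^ 2)
    have h3 := (h.deriv_p₃ t).div_const √(1 - a ^ 2)
    rw [velocity_eq]
    generalize √(1 - a ^ 2) = b at *
    intro i j
    fin_cases i <;> fin_cases j <;>
      simp [momentMatrix, hasDerivAt_const]
    · refine h3.neg.congr_deriv ?_
      field_simp; grind
    · refine h1.congr_deriv ?_
      field_simp
    · refine h3.congr_deriv ?_
      field_simp; grind
    · refine (hasDerivAt_const t 0).congr_deriv ?_
      ring
    · refine h2.neg.congr_deriv ?_
      field_simp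
    · refine h1.neg.congr_deriv ?_
      field_simp
    · refine h2.congr_deriv ?_
      field_simp
    · refine (hasDerivAt_const t 0).congr_deriv ?_
      ring
  have hconst := eq_of_hasEntryDerivAt_zero
    (Y := fun t => (R t).1 * momentMatrix √(1 - a ^ 2) (p t) * (R t).1.transpose) (fun t =>
      (((hasVelocityAt_iff.1 (h.horizontal t)).mul (hM t)).mul
        (hasVelocityAt_iff.1 (h.horizontal t)).transpose).congr_deriv (by
          rw [Matrix.transpose_mul, velocity_transpose]; noncomm_ring)) 0 t
  rw [hconst]
  calc _ = ((R t).1.transpose * (R t).1) * momentMatrix √(1 - a ^ 2) (p t) *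
        ((R t).1.transpose * (R t).1) := by simp only [mul_assoc]
    _ = _ := by rw [SO3.transpose_mul, one_mul, mul_one]

/-! ### Regularity of horizontal curves and the comparison argument -/

lemma IsHorizontalOn.absolutelyContinuous {a s t : ℝ} {Q : ℝ → SO3} {v : ℝ → ℝ × ℝ} (hst : s ≤ t)
    (h : IsHorizontalOn a Q v s t) (i j : Fin 3) :
    AbsolutelyContinuousOnInterval (fun x => (Q x).1 i j) s t := by
  obtain ⟨K, hK⟩ := h.1
  exact LipschitzOnWith.absolutelyContinuousOnInterval (by rw [uIcc_of_le hst]; exact hK i j)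

lemma IsHorizontalOn.ae_hasVelocityAt {a s t : ℝ} {Q : ℝ → SO3} {v : ℝ → ℝ × ℝ} (hst : s ≤ t)
    (h : IsHorizontalOn a Q v s t) :
    ∀ᵐ x, x ∈ uIcc s t → HasVelocityAt a Q (v x).1 (v x).2 x := by
  rw [uIcc_of_le hst]
  exact (ae_restrict_iff' measurableSet_Icc).1 h.2

/-- Controls carry no measurability assumption; they are recovered almost everywhere as entries of
QᵀQ', whose factors are continuous and integrable. -/
lemma IsHorizontalOn.intervalIntegrable {a s t : ℝ} (ha : a ∈ Ioo (0 : ℝ) 1) {Q : ℝ → SO3}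
    {v : ℝ → ℝ × ℝ} (hst : s ≤ t) (h : IsHorizontalOn a Q v s t) :
    IntervalIntegrable (fun x => (v x).1) volume s t ∧
      IntervalIntegrable (fun x => (v x).2) volume s t := by
  have hb := (sqrt_pos.2 (one_sub_sq_pos ha)).ne'
  have hQ := h.absolutelyContinuous hst
  have key (i j : Fin 3) :
      IntervalIntegrable (fun x => velocity a (v x).1 (v x).2 i j) volume s t := by
    have h1 : IntervalIntegrable
        (fun x => ∑ k, (Q x).1 k i * deriv (fun x => (Q x).1 k j) x) volume s t := by
      have := IntervalIntegrable.sum Finset.univ (f := fun k x =>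
        (Q x).1 k i * deriv (fun x => (Q x).1 k j) x) fun k _ =>
        (hQ k j).intervalIntegrable_deriv.continuousOn_mul (hQ k i).continuousOn
      simpa only [Finset.sum_fn] using this
    refine h1.congr_ae ?_
    rw [Filter.EventuallyEq, ae_restrict_iff' measurableSet_uIoc]
    filter_upwards [h.ae_hasVelocityAt hst] with x hx hxs
    have h2 := hasVelocityAt_iff.1 (hx (uIoc_subset_uIcc hxs))
    calc ∑ k, (Q x).1 k i * deriv (fun x => (Q x).1 k j) x
        = ((Q x).1.transpose * ((Q x).1 * velocity a (v x).1 (v x).2)) i j := by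
          rw [Matrix.mul_apply]
          exact Finset.sum_congr rfl fun k _ => by rw [(h2 k j).deriv, Matrix.transpose_apply]
      _ = _ := by rw [← mul_assoc, SO3.transpose_mul, one_mul]
  constructor
  · simpa [velocity_eq] using key 0 2
  · have := (key 2 1).div_const √(1 - a ^ 2)
    simpa [velocity_eq, hb] using this

lemma IsExtremal.lipschitzWith {a : ℝ} {R : ℝ → SO3} {p : ℝ → Covector} (h : IsExtremal a R p)
    (hp : ∀ t, (p t).p₁ ^ 2 + (p t).p₂ ^ 2 = 1) (i j : Fin 3) :
    LipschitzWith 6 fun t => (R t).1 i j := by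
  refine lipschitzWith_of_nnnorm_deriv_le (fun t => (h.horizontal t i j).differentiableAt)
    fun t => ?_
  rw [(h.horizontal t i j).deriv, ← NNReal.coe_le_coe, coe_nnnorm, norm_eq_abs]
  refine (abs_mul_apply_le (SO3.abs_apply_le_one (R t))
    (abs_velocity_apply_le (a := a) (p t).p₁ (p t).p₂) i j).trans ?_
  have h1 : |(p t).p₁| ≤ 1 := by
    rw [← sq_le_one_iff_abs_le_one]; nlinarith [hp t, sq_nonneg (p t).p₂]
  have h2 : |(p t).p₂| ≤ 1 := by
    rw [← sq_le_one_iff_abs_le_one]; nlinarith [hp t, sq_nonneg (p t).p₁]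
  norm_num; linarith

/-- Expanding |v|² ≤ ρ² with v = w + cρu gives -u·w ≥ (c² - 1)ρ/(2c) + |w|²/(2cρ). The quadratic
term is then replaced by a tangent line with parameter l. Choosing l = W/I after integration
recovers the Cauchy–Schwarz bound while only |w| and ρ have to be integrable. -/
lemma comparison_inequality {c ρ l u₁ u₂ v₁ v₂ w₁ w₂ : ℝ} (hc : 0 < c) (hρ : 0 < ρ)
    (hu : u₁ ^ 2 + u₂ ^ 2 = 1) (hv : v₁ ^ 2 + v₂ ^ 2 ≤ ρ ^ 2) (h₁ : w₁ = v₁ - c * ρ * u₁)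
    (h₂ : w₂ = v₂ - c * ρ * u₂) :
    (c ^ 2 - 1) / (2 * c) * ρ + (2 * l * (|w₁| + |w₂|) - l ^ 2 * ρ) / (4 * c) ≤
      -(u₁ * w₁ + u₂ * w₂) := by
  have h3 : -(4 * c * ρ * (u₁ * w₁ + u₂ * w₂)) =
      2 * (w₁ ^ 2 + w₂ ^ 2) + 2 * c ^ 2 * ρ ^ 2 - 2 * (v₁ ^ 2 + v₂ ^ 2) := by
    rw [h₁, h₂]; linear_combination (2 * c ^ 2 * ρ ^ 2) * hu
  have h4 : (|w₁| + |w₂|) ^ 2 ≤ 2 * (w₁ ^ 2 + w₂ ^ 2) := by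
    nlinarith [sq_nonneg (|w₁| - |w₂|), sq_abs w₁, sq_abs w₂]
  have h5 : (c ^ 2 - 1) / (2 * c) * ρ + (2 * l * (|w₁| + |w₂|) - l ^ 2 * ρ) / (4 * c) =
      (2 * (c ^ 2 - 1) * ρ ^ 2 + 2 * l * (|w₁| + |w₂|) * ρ - l ^ 2 * ρ ^ 2) / (4 * c * ρ) := by
    field_simp; ring
  rw [h5, div_le_iff₀ (by positivity)]
  nlinarith [sq_nonneg (|w₁| + |w₂| - l * ρ)]

/-- Every sufficiently short arc of an extremal is not longer than any horizontal curve with the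
same end points. -/
lemma IsExtremal.exists_short_arc_le {a : ℝ} (ha : a ∈ Ioo (0 : ℝ) 1) {R : ℝ → SO3}
    {p : ℝ → Covector} (h : IsExtremal a R p) (hp : ∀ t, (p t).p₁ ^ 2 + (p t).p₂ ^ 2 = 1) :
    ∃ δ > 0, ∀ s T T' : ℝ, 0 < T → T ≤ δ → 0 < T' → ∀ (Q : ℝ → SO3) (v : ℝ → ℝ × ℝ),
      IsHorizontalOn a Q v 0 T' → Q 0 = R s → Q T' = R (s + T) → T ≤ length v 0 T' := by
  set A := (R 0).1 * momentMatrix √(1 - a ^ 2) (p 0) * (R 0).1.transpose with hA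
  obtain ⟨M, hM0, hM⟩ : ∃ M : ℝ, 0 < M ∧ ∀ i j, |A i j| ≤ M := by
    refine ⟨1 + ∑ i, ∑ j, |A i j|, by positivity, fun i j => ?_⟩
    have h1 : |A i j| ≤ ∑ j, |A i j| := Finset.single_le_sum (f := fun j => |A i j|) (fun j _ => abs_nonneg _)
      (Finset.mem_univ j)
    have h2 : ∑ j, |A i j| ≤ ∑ i, ∑ j, |A i j| := Finset.single_le_sum (f := fun i => ∑ j, |A i j|)
      (fun i _ => Finset.sum_nonneg fun j _ => abs_nonneg _) (Finset.mem_univ i)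
    linarith
  -- This δ makes 1/(4T) ≥ 1100M for T ≤ δ: the convexity gain dominates the error of
  -- `exists_defect`. M bounds the conserved momentum, so δ does not depend on s.
  refine ⟨1 / (4 * (1100 * M)), by positivity, fun s T T' hT hTδ hT' Q v hQ h0 h1 => ?_⟩
  by_contra! hlt
  have hℓ0 : 0 ≤ length v 0 T' := intervalIntegral.integral_nonneg hT'.le fun x _ => sqrt_nonneg _
  obtain ⟨hv1, hv2⟩ := hQ.intervalIntegrable ha hT'.le
  have hvn := intervalIntegrable_sqrt_sq_add_sq hv1 hv2
  -- A regularized speed and the corresponding reparametrization of the extremal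
  obtain ⟨ε, hε, hεT⟩ : ∃ ε > 0, length v 0 T' + ε * T' < T :=
    ⟨(T - length v 0 T') / (2 * T'), div_pos (by linarith) (by linarith), by field_simp; linarith⟩
  set ρ : ℝ → ℝ := fun x => √((v x).1 ^ 2 + (v x).2 ^ 2) + ε with hρ
  have hρ0 (x) : 0 < ρ x := by positivity
  have hρi : IntervalIntegrable ρ volume 0 T' := hvn.add intervalIntegrable_const
  set I := ∫ x in (0 : ℝ)..T', ρ x with hI
  have hIT : I < T := by
    rw [hI, hρ, intervalIntegral.integral_add hvn intervalIntegrable_const,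
      intervalIntegral.integral_const]
    simp only [sub_zero, smul_eq_mul, mul_comm T']
    exact hεT
  have hI0 : 0 < I := intervalIntegral.intervalIntegral_pos_of_pos hρi hρ0 hT'
  -- I is the regularized length of the competitor; that it is shorter than T means c > 1.
  set c := T / I with hc
  have hcI : c * I = T := div_mul_cancel₀ _ hI0.ne'
  have hc1 : 1 < c := (one_lt_div hI0).2 hIT
  have hc0 : 0 < c := by linarith
  set ζ : ℝ → ℝ := fun x => c * ∫ y in (0 : ℝ)..x, ρ y with hζ
  have hζ0 : ζ 0 = 0 := by simp [hζ]
  have hζT : ζ T' = T := hcI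
  have hζac : AbsolutelyContinuousOnInterval ζ 0 T' :=
    (hρi.absolutelyContinuousOnInterval_intervalIntegral (c := 0) (by simp)).const_mul c
  have hζd : ∀ᵐ x, x ∈ uIcc 0 T' → HasDerivAt ζ (c * ρ x) x := by
    filter_upwards [hρi.ae_hasDerivAt_integral] with x hx hxT
    exact (hx hxT 0 left_mem_uIcc).const_mul c
  -- The arc of R run on the competitor's time interval with speed cρ, so that both curves share
  -- their end points.
  set P : ℝ → SO3 := fun x => R (s + ζ x) with hPdef
  set α : ℝ → ℝ × ℝ := fun x => (c * ρ x * (p (s + ζ x)).p₁, c * ρ x * (p (s + ζ x)).p₂) with hα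
  have hPac (i j) : AbsolutelyContinuousOnInterval (fun x => (P x).1 i j) 0 T' := by
    refine (h.lipschitzWith hp i j).comp_absolutelyContinuousOnInterval (g := fun x => s + ζ x) ?_
    exact (LipschitzWith.const s).lipschitzOnWith.absolutelyContinuousOnInterval.fun_add hζac
  have hPv : ∀ᵐ x, x ∈ uIcc 0 T' → HasVelocityAt a P (α x).1 (α x).2 x := by
    filter_upwards [hζd] with x hx hxT i j
    refine ((h.horizontal (s + ζ x) i j).comp x ((hx hxT).const_add s)).congr_deriv ?_
    have : velocity a (α x).1 (α x).2 =
        (c * ρ x) • velocity a (p (s + ζ x)).p₁ (p (s + ζ x)).p₂ := by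
      simp only [velocity, hα, smul_add, smul_smul]
    change _ = ((P x).1 * velocity a (α x).1 (α x).2) i j
    rw [this, Matrix.mul_smul, Matrix.smul_apply, smul_eq_mul, mul_comm]
    rfl
  set w : ℝ → ℝ × ℝ := fun x => ((v x).1 - (α x).1, (v x).2 - (α x).2) with hw
  have hαi {f : ℝ → ℝ} (hf : Continuous f) :
      IntervalIntegrable (fun x => c * ρ x * f (s + ζ x)) volume 0 T' :=
    (hρi.const_mul c).mul_continuousOn
      (hf.comp_continuousOn (continuousOn_const.add hζac.continuousOn))
  have hp1c : Continuous fun t => (p t).p₁ :=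
    continuous_iff_continuousAt.2 fun t => (h.deriv_p₁ t).continuousAt
  have hp2c : Continuous fun t => (p t).p₂ :=
    continuous_iff_continuousAt.2 fun t => (h.deriv_p₂ t).continuousAt
  have hwi : IntervalIntegrable (fun x => |(w x).1| + |(w x).2|) volume 0 T' :=
    (hv1.sub (hαi hp1c)).abs.add (hv2.sub (hαi hp2c)).abs
  obtain ⟨f', hf'i, hf'0, hf'⟩ := exists_defect hT' hPac (hQ.absolutelyContinuous hT'.le) hPv
    (hQ.ae_hasVelocityAt hT'.le) hw hwi (by simp only [hPdef, hζ0, add_zero, h0])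
    (by simp only [hPdef, hζT, h1]) hM
  set W := ∫ x in (0 : ℝ)..T', |(w x).1| + |(w x).2| with hW
  -- The convexity bound with l = W/I, less the second-order error; its right-hand side integrates
  -- to zero.
  have hlow : ∀ᵐ x ∂volume.restrict (Icc 0 T'),
      ((c ^ 2 - 1) / (2 * c) - (W / I) ^ 2 / (4 * c)) * ρ x +
        (2 * (W / I) / (4 * c) - 1100 * M * W) * (|(w x).1| + |(w x).2|) ≤ -f' x := by
    rw [ae_restrict_iff' measurableSet_Icc]
    filter_upwards [hf'] with x hx hxT
    have h2 := hx (by rwa [uIcc_of_le hT'.le])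
    simp only [hPdef] at h2
    rw [h.momentMatrix_eq ha, pairing_momentMatrix ha] at h2
    have h3 := comparison_inequality (l := W / I) hc0 (hρ0 x) (hp (s + ζ x))
      (v₁ := (v x).1) (v₂ := (v x).2) (w₁ := (w x).1) (w₂ := (w x).2) (by
        rw [← sqrt_le_left (hρ0 x).le]; simp only [hρ]; linarith) rfl rfl
    have h4 := (abs_le.1 h2).2
    have h5 : ((c ^ 2 - 1) / (2 * c) - (W / I) ^ 2 / (4 * c)) * ρ x +
        (2 * (W / I) / (4 * c) - 1100 * M * W) * (|(w x).1| + |(w x).2|) =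
        (c ^ 2 - 1) / (2 * c) * ρ x +
          (2 * (W / I) * (|(w x).1| + |(w x).2|) - (W / I) ^ 2 * ρ x) / (4 * c) -
          1100 * M * W * (|(w x).1| + |(w x).2|) := by ring
    rw [h5]
    linarith
  have hint := intervalIntegral.integral_mono_ae_restrict hT'.le
    ((hρi.const_mul _).add (hwi.const_mul _)) hf'i.neg hlow
  rw [intervalIntegral.integral_add (hρi.const_mul _) (hwi.const_mul _),
    intervalIntegral.integral_const_mul, intervalIntegral.integral_const_mul, ← hI, ← hW] at hint
  simp only [Pi.neg_apply] at hint
  rw [intervalIntegral.integral_neg, hf'0, neg_zero] at hint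
  -- The tangent-line terms combine to 2W²/I - W²/I, leaving W²/(4cI) = W²/(4T). All terms are then
  -- nonnegative and the one with c² - 1 is positive, against an upper bound of zero.
  have h6 : ((c ^ 2 - 1) / (2 * c) - (W / I) ^ 2 / (4 * c)) * I +
      (2 * (W / I) / (4 * c) - 1100 * M * W) * W =
      (c ^ 2 - 1) / (2 * c) * I + (1 / (4 * (c * I)) - 1100 * M) * W ^ 2 := by
    field_simp; ring
  rw [h6, hcI] at hint
  have h7 : 0 < (c ^ 2 - 1) / (2 * c) * I :=
    mul_pos (div_pos (by nlinarith) (by linarith)) hI0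
  have h8 : 0 ≤ 1 / (4 * T) - 1100 * M := by
    rw [sub_nonneg, le_div_iff₀ (by positivity)]
    rw [le_div_iff₀ (by positivity)] at hTδ
    linarith
  have h9 := mul_nonneg h8 (sq_nonneg W)
  linarith

/-- Extremals parametrized by arclength are geodesics. -/
lemma IsExtremal.isGeodesic {a : ℝ} (ha : a ∈ Ioo (0 : ℝ) 1) {R : ℝ → SO3}
    {p : ℝ → Covector} (h : IsExtremal a R p) (hp : (p 0).p₁ ^ 2 + (p 0).p₂ ^ 2 = 1) :
    IsGeodesic a R := by
  have hp' (t) : (p t).p₁ ^ 2 + (p t).p₂ ^ 2 = 1 := (h.isCostate.sq_add_sq_eq t).trans hp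
  obtain ⟨δ, hδ, hmin⟩ := h.exists_short_arc_le ha hp'
  refine ⟨fun t => ((p t).p₁, (p t).p₂), fun s t _ =>
    ⟨⟨6, fun i j => (h.lipschitzWith hp' i j).lipschitzOnWith⟩,
      Filter.Eventually.of_forall h.horizontal⟩, Filter.Eventually.of_forall hp', fun τ =>
    ⟨δ / 2, by positivity, fun T' Q v hT' hQ h0 h1 => ?_⟩⟩
  have hlen : length (fun t => ((p t).p₁, (p t).p₂)) (τ - δ / 2) (τ + δ / 2) = δ := by
    simp only [length, hp', sqrt_one, intervalIntegral.integral_const, smul_eq_mul]; ring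
  have hend : τ + δ / 2 = τ - δ / 2 + δ := by ring
  rw [hlen]
  rw [hend] at h1
  -- A competitor on a degenerate interval is a single point; a constant curve on [0, 1] replaces
  -- it, and the short-arc bound would give δ ≤ 0.
  rcases hT'.eq_or_lt with rfl | hT'
  · have hconst : IsHorizontalOn a (fun _ => Q 0) (fun _ => (0, 0)) 0 1 := by
      refine ⟨⟨0, fun i j => (LipschitzWith.const _).lipschitzOnWith⟩,
        Filter.Eventually.of_forall fun t i j => ?_⟩
      simpa using hasDerivAt_const t ((Q 0).1 i j)
    have := hmin (τ - δ / 2) δ 1 hδ le_rfl one_pos _ _ hconst h0 h1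
    simp [length] at this
    linarith
  · exact hmin _ _ _ hδ le_rfl hT' Q v hQ h0 h1

section

/-! ### The classification of periodic geodesics -/

lemma lt_G₁ {a k : ℝ} (ha : a ∈ Ioo (0 : ℝ) 1) (hk : k ∈ Ioo (0 : ℝ) 1) :
    π / 2 * (1 / a) < G₁ a k := by
  rw [← G₁_zero ha]
  exact strictMonoOn_G₁ ha ⟨le_rfl, one_pos⟩ ⟨hk.1.le, hk.2⟩ hk.1

lemma lt_G₂ {a k : ℝ} (ha : a ∈ Ioo (0 : ℝ) 1) (hk : k ∈ Ioo (0 : ℝ) 1) : π / 2 < G₂ a k := by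
  rw [← G₂_zero ha]
  exact strictMonoOn_G₂ ha ⟨le_rfl, one_pos⟩ ⟨hk.1.le, hk.2⟩ hk.1

variable {a : ℝ}

theorem periodic_geodesics_C₁ (ha : a ∈ Ioo (0 : ℝ) 1) (n m : ℕ) (hm : 0 < m)
    (hnm : n.Coprime m) (h : 1 / a < (n : ℝ) / m) :
    ∃ k ∈ Ioo (0 : ℝ) 1, G₁ a k = π / 2 * ((n : ℝ) / m) ∧
      (∀ k' ∈ Ioo (0 : ℝ) 1, G₁ a k' = π / 2 * ((n : ℝ) / m) → k' = k) ∧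
      (∃ R p, R 0 = 1 ∧ IsExtremal a R p ∧ p 0 ∈ C₁ a ∧ modulus₁ a (p 0) = k) ∧
      (∀ R p, IsExtremal a R p → p 0 ∈ C₁ a → modulus₁ a (p 0) = k →
        IsGeodesic a R ∧ IsMinimalPeriod R (m * (4 * ellipticK (k ^ 2) / a))) := by
  obtain ⟨k, hk, hG, huniq⟩ := existsUnique_of_strictMonoOn (strictMonoOn_G₁ ha)
    (continuousOn_G₁ ha) (exists_G₁_gt ha) (y := π / 2 * ((n : ℝ) / m))
    (by rw [G₁_zero ha]; gcongr)
  refine ⟨k, hk, hG, huniq, exists_extremal_C₁ ha hk, ?_⟩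
  rintro R p hR hp rfl
  have hK := ellipticK_pos (sq_mem_Ico ⟨hk.1.le, hk.2⟩).2
  exact ⟨hR.isGeodesic ha hp.1, isMinimalPeriod_of_periodic_iff
    (div_pos (by positivity) ha.1) (periodic_iff_of_mem_C₁ ha hR hp) hm hnm hG⟩

theorem periodic_geodesics_C₂ (ha : a ∈ Ioo (0 : ℝ) 1) (n m : ℕ) (hm : 0 < m)
    (hnm : n.Coprime m) (h : 1 < (n : ℝ) / m) :
    ∃ k ∈ Ioo (0 : ℝ) 1, G₂ a k = π / 2 * ((n : ℝ) / m) ∧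
      (∀ k' ∈ Ioo (0 : ℝ) 1, G₂ a k' = π / 2 * ((n : ℝ) / m) → k' = k) ∧
      (∃ R p, R 0 = 1 ∧ IsExtremal a R p ∧ p 0 ∈ C₂ a ∧ modulus₂ a (p 0) = k) ∧
      (∀ R p, IsExtremal a R p → p 0 ∈ C₂ a → modulus₂ a (p 0) = k →
        IsGeodesic a R ∧ IsMinimalPeriod R (m * (4 * k * ellipticK (k ^ 2) / a))) := by
  obtain ⟨k, hk, hG, huniq⟩ := existsUnique_of_strictMonoOn (strictMonoOn_G₂ ha)
    (continuousOn_G₂ ha) (exists_G₂_gt ha) (y := π / 2 * ((n : ℝ) / m))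
    (by rw [G₂_zero ha]; exact lt_mul_of_one_lt_right (by positivity) h)
  refine ⟨k, hk, hG, huniq, exists_extremal_C₂ ha hk, ?_⟩
  rintro R p hR hp rfl
  have hK := ellipticK_pos (sq_mem_Ico ⟨hk.1.le, hk.2⟩).2
  have hk0 := hk.1
  exact ⟨hR.isGeodesic ha hp.1, isMinimalPeriod_of_periodic_iff
    (div_pos (by positivity) ha.1) (periodic_iff_of_mem_C₂ ha hR hp) hm hnm hG⟩

theorem exists_fraction_C₁ (ha : a ∈ Ioo (0 : ℝ) 1) {R : ℝ → SO3} {p : ℝ → Covector}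
    (hR : IsExtremal a R p) (hp : p 0 ∈ C₁ a) (hper : IsPeriodic R) :
    ∃ n m : ℕ, 0 < m ∧ n.Coprime m ∧ 1 / a < (n : ℝ) / m ∧
      G₁ a (modulus₁ a (p 0)) = π / 2 * ((n : ℝ) / m) := by
  have hk := (exists_eq_oscillating ha.1 hp).1
  have hK := ellipticK_pos (sq_mem_Ico ⟨hk.1.le, hk.2⟩).2
  have hG := lt_G₁ ha hk
  have ha0 := ha.1
  obtain ⟨n, m, hm, hnm, h⟩ := exists_fraction_of_periodic_iff (div_pos (by positivity) ha.1)
    (lt_trans (by positivity) hG) (periodic_iff_of_mem_C₁ ha hR hp) hper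
  refine ⟨n, m, hm, hnm, ?_, h⟩
  rw [h] at hG
  exact lt_of_mul_lt_mul_left hG (by positivity)

theorem exists_fraction_C₂ (ha : a ∈ Ioo (0 : ℝ) 1) {R : ℝ → SO3} {p : ℝ → Covector}
    (hR : IsExtremal a R p) (hp : p 0 ∈ C₂ a) (hper : IsPeriodic R) :
    ∃ n m : ℕ, 0 < m ∧ n.Coprime m ∧ 1 < (n : ℝ) / m ∧
      G₂ a (modulus₂ a (p 0)) = π / 2 * ((n : ℝ) / m) := by
  have hk := (exists_eq_rotating ha.1 hp).1
  have hK := ellipticK_pos (sq_mem_Ico ⟨hk.1.le, hk.2⟩).2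
  have hG := lt_G₂ ha hk
  have hk0 := hk.1
  obtain ⟨n, m, hm, hnm, h⟩ := exists_fraction_of_periodic_iff (div_pos (by positivity) ha.1)
    (lt_trans (by positivity) hG) (periodic_iff_of_mem_C₂ ha hR hp) hper
  refine ⟨n, m, hm, hnm, ?_, h⟩
  rw [h] at hG
  exact lt_of_mul_lt_mul_left (by rwa [mul_one]) (by positivity : 0 ≤ π / 2)

/-- Congruent curves share their energy, hence the modulus and the fraction. Equal fractions give
equal moduli by injectivity of `G₁`, and then the curves are congruent. -/
theorem congruent_iff_C₁ (ha : a ∈ Ioo (0 : ℝ) 1) {R R' : ℝ → SO3} {p p' : ℝ → Covector}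
    {q q' : ℚ} (hR : IsExtremal a R p) (hR' : IsExtremal a R' p') (hp : p 0 ∈ C₁ a)
    (hp' : p' 0 ∈ C₁ a) (h : G₁ a (modulus₁ a (p 0)) = π / 2 * q)
    (h' : G₁ a (modulus₁ a (p' 0)) = π / 2 * q') : Congruent R R' ↔ q = q' := by
  have hk := (exists_eq_oscillating ha.1 hp).1
  have hk' := (exists_eq_oscillating ha.1 hp').1
  constructor
  · intro hc
    have hE := energy_eq_of_congruent ha hR hR' hp.1 hp'.1 hc
    rw [modulus₁, hE, ← modulus₁, h] at h'
    exact_mod_cast mul_left_cancel₀ (by positivity) h'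
  · rintro rfl
    exact congruent_of_modulus₁_eq ha hR hR' hp hp' <| (strictMonoOn_G₁ ha).injOn
      ⟨hk.1.le, hk.2⟩ ⟨hk'.1.le, hk'.2⟩ (h.trans h'.symm)

theorem congruent_iff_C₂ (ha : a ∈ Ioo (0 : ℝ) 1) {R R' : ℝ → SO3} {p p' : ℝ → Covector}
    {q q' : ℚ} (hR : IsExtremal a R p) (hR' : IsExtremal a R' p') (hp : p 0 ∈ C₂ a)
    (hp' : p' 0 ∈ C₂ a) (h : G₂ a (modulus₂ a (p 0)) = π / 2 * q)
    (h' : G₂ a (modulus₂ a (p' 0)) = π / 2 * q') : Congruent R R' ↔ q = q' := by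
  have hk := (exists_eq_rotating ha.1 hp).1
  have hk' := (exists_eq_rotating ha.1 hp').1
  constructor
  · intro hc
    have hE := energy_eq_of_congruent ha hR hR' hp.1 hp'.1 hc
    rw [modulus₂, hE, ← modulus₂, h] at h'
    exact_mod_cast mul_left_cancel₀ (by positivity) h'
  · rintro rfl
    exact congruent_of_modulus₂_eq ha hR hR' hp hp' <| (strictMonoOn_G₂ ha).injOn
      ⟨hk.1.le, hk.2⟩ ⟨hk'.1.le, hk'.2⟩ (h.trans h'.symm)

theorem exists_infinite_family (ha : a ∈ Ioo (0 : ℝ) 1) :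
    ∃ γ : ℕ → ℝ → SO3, (∀ i, γ i 0 = 1 ∧ IsGeodesic a (γ i) ∧ IsPeriodic (γ i)) ∧
      ∀ i j, i ≠ j → ¬ Congruent (γ i) (γ j) := by
  -- The integers N + i, as fractions with denominator 1, all exceed 1/a and are pairwise distinct.
  obtain ⟨N, hN⟩ := exists_nat_gt (1 / a)
  have key (i : ℕ) : ∃ (R : ℝ → SO3) (p : ℝ → Covector), (R 0 = 1 ∧ IsGeodesic a R ∧ IsPeriodic R) ∧
      IsExtremal a R p ∧ p 0 ∈ C₁ a ∧ G₁ a (modulus₁ a (p 0)) = π / 2 * ((N + i : ℕ) : ℚ) := by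
    obtain ⟨k, -, hG, -, ⟨R, p, h0, hR, hp, rfl⟩, hall⟩ := periodic_geodesics_C₁ ha (N + i) 1
      one_pos (Nat.coprime_one_right _)
      (by push_cast; rw [div_one]; linarith [(Nat.cast_nonneg i : (0 : ℝ) ≤ i)])
    obtain ⟨hgeo, ⟨hL, hper⟩, -⟩ := hall R p hR hp rfl
    refine ⟨R, p, ⟨h0, hgeo, _, hL, hper⟩, hR, hp, ?_⟩
    rw [hG]; simp
  choose γ p hγ hext hp hG using key
  refine ⟨γ, hγ, fun i j hij hc => hij ?_⟩
  have := (congruent_iff_C₁ ha (hext i) (hext j) (hp i) (hp j) (hG i) (hG j)).1 hc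
  have h2 : N + i = N + j := by exact_mod_cast this
  omega

end

end SRSO3

end

theorem mainTheorem2 (a : ℝ) (ha : a ∈ Set.Ioo (0 : ℝ) 1) :
    -- there are infinitely many periodic geodesics, even up to congruence
    (∃ γ : ℕ → ℝ → SRSO3.SO3,
      (∀ i, γ i 0 = 1 ∧ SRSO3.IsGeodesic a (γ i) ∧ SRSO3.IsPeriodic (γ i)) ∧
      ∀ i j, i ≠ j → ¬ SRSO3.Congruent (γ i) (γ j)) ∧
    -- covectors in `C₁`: each reduced fraction `n / m > 1 / a` yields one modulus, and a geodesic
    (∀ n m : ℕ, 0 < m → n.Coprime m → 1 / a < (n : ℝ) / m →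
      ∃ k ∈ Set.Ioo (0 : ℝ) 1, SRSO3.G₁ a k = Real.pi / 2 * ((n : ℝ) / m) ∧
        (∀ k' ∈ Set.Ioo (0 : ℝ) 1, SRSO3.G₁ a k' = Real.pi / 2 * ((n : ℝ) / m) → k' = k) ∧
        (∃ R p, R 0 = 1 ∧ SRSO3.IsExtremal a R p ∧ p 0 ∈ SRSO3.C₁ a ∧
          SRSO3.modulus₁ a (p 0) = k) ∧
        (∀ R p, SRSO3.IsExtremal a R p → p 0 ∈ SRSO3.C₁ a → SRSO3.modulus₁ a (p 0) = k →
          SRSO3.IsGeodesic a R ∧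
          SRSO3.IsMinimalPeriod R (m * (4 * SRSO3.ellipticK (k ^ 2) / a)))) ∧
    -- all periodic ones arise in this way
    (∀ R p, SRSO3.IsExtremal a R p → p 0 ∈ SRSO3.C₁ a → SRSO3.IsPeriodic R →
      ∃ n m : ℕ, 0 < m ∧ n.Coprime m ∧ 1 / a < (n : ℝ) / m ∧
        SRSO3.G₁ a (SRSO3.modulus₁ a (p 0)) = Real.pi / 2 * ((n : ℝ) / m)) ∧
    -- they are congruent exactly when the fractions coincide
    (∀ R p R' p' (q q' : ℚ), SRSO3.IsExtremal a R p → SRSO3.IsExtremal a R' p' →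
      p 0 ∈ SRSO3.C₁ a → p' 0 ∈ SRSO3.C₁ a →
      SRSO3.G₁ a (SRSO3.modulus₁ a (p 0)) = Real.pi / 2 * q →
      SRSO3.G₁ a (SRSO3.modulus₁ a (p' 0)) = Real.pi / 2 * q' →
      (SRSO3.Congruent R R' ↔ q = q')) ∧
    -- covectors in `C₂`: the same for each reduced fraction `n / m > 1`
    (∀ n m : ℕ, 0 < m → n.Coprime m → 1 < (n : ℝ) / m →
      ∃ k ∈ Set.Ioo (0 : ℝ) 1, SRSO3.G₂ a k = Real.pi / 2 * ((n : ℝ) / m) ∧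
        (∀ k' ∈ Set.Ioo (0 : ℝ) 1, SRSO3.G₂ a k' = Real.pi / 2 * ((n : ℝ) / m) → k' = k) ∧
        (∃ R p, R 0 = 1 ∧ SRSO3.IsExtremal a R p ∧ p 0 ∈ SRSO3.C₂ a ∧
          SRSO3.modulus₂ a (p 0) = k) ∧
        (∀ R p, SRSO3.IsExtremal a R p → p 0 ∈ SRSO3.C₂ a → SRSO3.modulus₂ a (p 0) = k →
          SRSO3.IsGeodesic a R ∧
          SRSO3.IsMinimalPeriod R (m * (4 * k * SRSO3.ellipticK (k ^ 2) / a)))) ∧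
    (∀ R p, SRSO3.IsExtremal a R p → p 0 ∈ SRSO3.C₂ a → SRSO3.IsPeriodic R →
      ∃ n m : ℕ, 0 < m ∧ n.Coprime m ∧ 1 < (n : ℝ) / m ∧
        SRSO3.G₂ a (SRSO3.modulus₂ a (p 0)) = Real.pi / 2 * ((n : ℝ) / m)) ∧
    (∀ R p R' p' (q q' : ℚ), SRSO3.IsExtremal a R p → SRSO3.IsExtremal a R' p' →
      p 0 ∈ SRSO3.C₂ a → p' 0 ∈ SRSO3.C₂ a →
      SRSO3.G₂ a (SRSO3.modulus₂ a (p 0)) = Real.pi / 2 * q →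
      SRSO3.G₂ a (SRSO3.modulus₂ a (p' 0)) = Real.pi / 2 * q' →
      (SRSO3.Congruent R R' ↔ q = q')) := by
  refine ⟨SRSO3.exists_infinite_family ha, SRSO3.periodic_geodesics_C₁ ha,
    fun R p hR hp hper => SRSO3.exists_fraction_C₁ ha hR hp hper,
    fun R p R' p' q q' hR hR' hp hp' h h' => SRSO3.congruent_iff_C₁ ha hR hR' hp hp' h h',
    SRSO3.periodic_geodesics_C₂ ha,
    fun R p hR hp hper => SRSO3.exists_fraction_C₂ ha hR hp hper,
    fun R p R' p' q q' hR hR' hp hp' h h' => SRSO3.congruent_iff_C₂ ha hR hR' hp hp' h h'⟩
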